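/- Let $p\ge 2$ be an integer, $\alpha_+=\sqrt{2p}$, $\alpha_-=-\sqrt{2/p}$, $\alpha_0=\alpha_++\alpha_-$, and $\alpha_{1,s;n}=\tfrac{1-s}{2}\alpha_-+\tfrac n2\alpha_+$. The modules of the singlet vertex operator algebra $\mathcal M(p)$ under consideration are the standard modules (Fock modules) $\mathcal F_\lambda$, $\lambda\in\mathbb C$, and the modules $M_{r,s}$, $r\in\mathbb Z$, $1\le s\le p$; every simple $\mathcal M(p)$-module is among them, and $V=\mathcal M(p)=M_{1,1}$. Their regularised characters are, with $q=e^{2\pi i\tau}$, $$\mathrm{ch}[\mathcal F_\lambda^\epsilon](\tau)=e^{2\pi\epsilon(\lambda-\alpha_0/2)}\frac{q^{(\lambda-\alpha_0/2)^2/2}}{\eta(\tau)},\qquad \mathrm{ch}[M_{r,s}^\epsilon]=\sum_{k\ge0}\Big(\mathrm{ch}[\mathcal F^\epsilon_{\alpha_{1,s;r-1-2k}}]-\mathrm{ch}[\mathcal F^\epsilon_{\alpha_{1,p-s;r-2-2k}}]\Big)\ (s<p),$$ and $\mathrm{ch}[M_{r,p}^\epsilon]=\mathrm{ch}[\mathcal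 F^\epsilon_{\alpha_{1,p;r-1}}]$. The regularised quantum dimension of $X$ is $\mathrm{qdim}[X^\epsilon]=\lim_{y\to0^+}\mathrm{ch}[X^\epsilon](iy)/\mathrm{ch}[V^\epsilon](iy)$. Put $$B_\epsilon^p=-\min\Big\{\Big|\tfrac{m}{\sqrt{2p}}-\mathrm{Im}\,\epsilon\Big| : m\in\mathbb Z\setminus p\mathbb Z\Big\},\qquad D_+=\{\epsilon\in\mathbb C:\mathrm{Re}\,\epsilon>B^p_\epsilon,\ \mathrm{Re}\,\epsilon\ne0\},$$ and let $D_-$ be the set of $\epsilon\in\mathbb C$ with $\mathrm{Re}\,\epsilon<B_\epsilon^p$ for which the minimum is attained by exactly one $m$. Then: 1. For $\epsilon\in D_+\cup D_-$ all these quantum dimensions exist (and the denominator $\mathrm{ch}[V^\epsilon](iy)$ does not vanish for small $y>0$). 2. The space of regularised quantum dimensions has an induced ring structure: for $\epsilon\in D_+\cup D_-$ the map $X\mapsto\mathrm{qdim}[X^\epsilon]$ is multiplicative for the (commutative) Verlinde product $$\mathcal F_\lambda\times\mathcal F_\mu=\sum_{j=0}^{p-1}\mathcal F_{\lambda+\mu+j\alpha_-},\qquad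 M_{r,s}\times\mathcal F_\mu=\sum_{j=0}^{s-1}\mathcal F_{\mu+\alpha_{1,s-2j;r-1}},\qquad M_{r,s}\times M_{r',s'}=\sum_{j=0}^{\min(s,s')-1}T_{r+r'-1,\,s+s'-1-2j},$$ where $T_{r,\ell}=M_{r,\ell}$ if $\ell\le p$, and $T_{r,\ell}=M_{r,2p-\ell}+M_{r+1,\ell-p}+M_{r-1,\ell-p}$ if $\ell>p$. For every $U\subseteq D_+\cup D_-$ the additive group of functions on $U$ generated by the functions $\epsilon\mapsto\mathrm{qdim}[X^\epsilon]$ is a unital subring of the ring of functions $U\to\mathbb C$. 3. On $U=D_-$ this ring is isomorphic to the fusion ring of $A_1^{(1)}$ at level $k=p-2$, that is, to the free abelian group on $[0],\dots,[k]$ with product $[a][b]=\sum_cN_{ab}{}^c[c]$, where $N_{ab}{}^c$ is given by the Verlinde formula $N_{ab}{}^c=\sum_{\ell=0}^{k}S_{a\ell}S_{b\ell}(S^{-1})_{\ell c}/S_{0\ell}$ with $S_{ab}=\sqrt{\tfrac{2}{k+2}}\sin\big(\pi\tfrac{(a+1)(b+1)}{k+2}\big)$ (explicitly, $N_{ab}{}^c=1$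 if $|a-b|\le c\le\min(a+b,2k-a-b)$ and $a+b+c$ is even, and $0$ otherwise). There is an isomorphism under which $\mathrm{qdim}[M_{1,a+1}^\epsilon]$ corresponds to $[a]$ for $0\le a\le k$, and these $p-1$ functions on $D_-$ are linearly independent over $\mathbb C$. -/

import Mathlib

open Filter Topology

/-! ## The fusion ring of the affine vertex operator algebra `A_1^(1)` at level `k` -/

/-- The modular `S`-matrix of `A_1^(1)` at level `k`; the label `a : Fin (k + 1)` stands for the
irreducible module with Dynkin label `a`, and `0` is the vacuum module. -/
noncomputable def affineS (k : ℕ) : Matrix (Fin (k + 1)) (Fin (k + 1)) ℝ :=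
  Matrix.of fun a b =>
    Real.sqrt (2 / ((k : ℝ) + 2)) *
      Real.sin (Real.pi * (((a : ℕ) : ℝ) + 1) * (((b : ℕ) : ℝ) + 1) / ((k : ℝ) + 2))

/-- The fusion coefficients of `A_1^(1)` at level `k`: `N_{ab}^c = 1` if
`|a - b| ≤ c ≤ min (a + b) (2 k - a - b)` and `a + b + c` is even, and `N_{ab}^c = 0` otherwise.
They are the numbers given by the Verlinde formula, see `affineFusion_eq_verlinde`. -/
def affineFusion (k : ℕ) (a b c : Fin (k + 1)) : ℤ :=
  if (a : ℕ) ≤ b + c ∧ (b : ℕ) ≤ a + c ∧ (c : ℕ) ≤ a + b ∧ (a + b + c : ℕ) ≤ 2 * k ∧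
      (a + b + c : ℕ) % 2 = 0 then 1 else 0

/-- The fusion ring of `A_1^(1)` at level `k`: the free abelian group on the irreducible modules,
with the product `[a] [b] = ∑ c, N_{ab}^c [c]`. -/
def AffineFusionRing (k : ℕ) : Type := Fin (k + 1) → ℤ

namespace AffineFusionRing

instance (k : ℕ) : AddCommGroup (AffineFusionRing k) :=
  inferInstanceAs (AddCommGroup (Fin (k + 1) → ℤ))

/-- The class of the irreducible module with label `a`. -/
def cls (k : ℕ) (a : Fin (k + 1)) : AffineFusionRing k := Pi.single a (1 : ℤ)

instance (k : ℕ) : Mul (AffineFusionRing k) :=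
  ⟨fun x y c => ∑ a, ∑ b, x a * y b * affineFusion k a b c⟩

instance (k : ℕ) : One (AffineFusionRing k) := ⟨cls k 0⟩

theorem mul_apply (k : ℕ) (x y : AffineFusionRing k) (c : Fin (k + 1)) :
    (x * y) c = ∑ a, ∑ b, x a * y b * affineFusion k a b c := rfl

end AffineFusionRing

section FusionFacts

theorem sum_cos_aux (φ : ℝ) (n : ℕ) :
    2 * Real.sin (φ / 2) * ∑ m ∈ Finset.range n, Real.cos ((m + 1 : ℝ) * φ) =
      Real.sin ((n + 1 / 2 : ℝ) * φ) - Real.sin (φ / 2) := by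
  induction n with
  | zero => simp; ring_nf
  | succ n ih =>
    rw [Finset.sum_range_succ, mul_add, ih]
    have h1 : Real.sin (((n + 1 : ℕ) + 1 / 2 : ℝ) * φ) =
        Real.sin ((n + 1 : ℝ) * φ + φ / 2) := by congr 1; push_cast; ring
    have h2 : Real.sin ((n + 1 / 2 : ℝ) * φ) =
        Real.sin ((n + 1 : ℝ) * φ - φ / 2) := by congr 1; ring
    rw [h1, h2, Real.sin_add, Real.sin_sub]
    ring

theorem sin_half_ne_zero (k : ℕ) (j : ℤ) (hj : j ≠ 0) (hj1 : |j| < 2 * ((k : ℤ) + 2)) :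
    Real.sin (Real.pi * j / ((k : ℝ) + 2) / 2) ≠ 0 := by
  have hN : (0 : ℝ) < (k : ℝ) + 2 := by positivity
  intro h
  rw [Real.sin_eq_zero_iff] at h
  obtain ⟨n, hn⟩ := h
  have h3 : (n : ℝ) * (2 * ((k : ℝ) + 2)) = j := by
    have hpi := Real.pi_ne_zero
    field_simp at hn
    linarith
  have h4 : n * (2 * ((k : ℤ) + 2)) = j := by exact_mod_cast h3
  rcases eq_or_ne n 0 with h0 | h0
  · subst h0; simp at h4; exact hj h4.symm
  · have : 1 ≤ |n| := Int.one_le_abs h0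
    rw [← h4, abs_mul, abs_of_pos (by positivity : (0 : ℤ) < 2 * ((k : ℤ) + 2))] at hj1
    nlinarith [(by positivity : (0 : ℤ) < 2 * ((k : ℤ) + 2))]

/-- `∑_{0 < m < k + 2} cos (π j m / (k + 2)) = -(1 + (-1)^j) / 2` for `0 < |j| < 2 (k + 2)`. -/
theorem sum_cos (k : ℕ) (j : ℤ) (hj : j ≠ 0) (hj1 : |j| < 2 * ((k : ℤ) + 2)) :
    ∑ m ∈ Finset.range (k + 1), Real.cos ((m + 1 : ℝ) * (Real.pi * j / ((k : ℝ) + 2))) =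
      -(1 + (-1) ^ j) / 2 := by
  have hN : (0 : ℝ) < (k : ℝ) + 2 := by positivity
  have hs := sin_half_ne_zero k j hj hj1
  set φ : ℝ := Real.pi * j / ((k : ℝ) + 2) with hφ
  have h := sum_cos_aux φ (k + 1)
  have h1 : Real.sin (((k + 1 : ℕ) + 1 / 2 : ℝ) * φ) = -((-1) ^ j * Real.sin (φ / 2)) := by
    have : ((k + 1 : ℕ) + 1 / 2 : ℝ) * φ = j * Real.pi - φ / 2 := by
      rw [hφ]; push_cast; field_simp; ring
    rw [this, Real.sin_int_mul_pi_sub]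
  rw [h1] at h
  have h2 : 2 * Real.sin (φ / 2) ≠ 0 := by positivity
  apply mul_left_cancel₀ h2
  rw [h]; ring

theorem affineS_symm (k : ℕ) (a b : Fin (k + 1)) : affineS k a b = affineS k b a := by
  simp only [affineS, Matrix.of_apply]
  congr 2; ring

theorem affineS_mul_self (k : ℕ) : affineS k * affineS k = 1 := by
  have hN : (0 : ℝ) < (k : ℝ) + 2 := by positivity
  ext a c
  rw [Matrix.mul_apply]
  have key : ∀ l : Fin (k + 1), affineS k a l * affineS k l c = (1 / ((k : ℝ) + 2)) *
      (Real.cos ((((l : ℕ) : ℝ) + 1) *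
          (Real.pi * (((a : ℕ) : ℤ) - ((c : ℕ) : ℤ) : ℤ) / ((k : ℝ) + 2))) -
        Real.cos ((((l : ℕ) : ℝ) + 1) *
          (Real.pi * (((a : ℕ) : ℤ) + ((c : ℕ) : ℤ) + 2 : ℤ) / ((k : ℝ) + 2)))) := by
    intro l
    simp only [affineS, Matrix.of_apply]
    have hsq : Real.sqrt (2 / ((k : ℝ) + 2)) * Real.sqrt (2 / ((k : ℝ) + 2)) =
        2 / ((k : ℝ) + 2) := Real.mul_self_sqrt (by positivity)
    set A := Real.pi * (((a : ℕ) : ℝ) + 1) * (((l : ℕ) : ℝ) + 1) / ((k : ℝ) + 2) with hA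
    set C := Real.pi * (((l : ℕ) : ℝ) + 1) * (((c : ℕ) : ℝ) + 1) / ((k : ℝ) + 2) with hC
    have e1 : (((l : ℕ) : ℝ) + 1) *
        (Real.pi * (((a : ℕ) : ℤ) - ((c : ℕ) : ℤ) : ℤ) / ((k : ℝ) + 2)) = A - C := by
      rw [hA, hC]; push_cast; ring
    have e2 : (((l : ℕ) : ℝ) + 1) *
        (Real.pi * (((a : ℕ) : ℤ) + ((c : ℕ) : ℤ) + 2 : ℤ) / ((k : ℝ) + 2)) = A + C := by
      rw [hA, hC]; push_cast; ring
    rw [e1, e2, Real.cos_sub, Real.cos_add]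
    linear_combination (Real.sin A * Real.sin C) * hsq
  rw [Finset.sum_congr rfl fun l _ => key l, ← Finset.mul_sum, Finset.sum_sub_distrib]
  have ha := a.isLt
  have hc := c.isLt
  rw [Fin.sum_univ_eq_sum_range (fun l : ℕ => Real.cos (((l : ℝ) + 1) *
      (Real.pi * (((a : ℕ) : ℤ) - ((c : ℕ) : ℤ) : ℤ) / ((k : ℝ) + 2)))) (k + 1),
    Fin.sum_univ_eq_sum_range (fun l : ℕ => Real.cos (((l : ℝ) + 1) *
      (Real.pi * (((a : ℕ) : ℤ) + ((c : ℕ) : ℤ) + 2 : ℤ) / ((k : ℝ) + 2)))) (k + 1),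
    sum_cos k (((a : ℕ) : ℤ) + ((c : ℕ) : ℤ) + 2) (by omega) (by rw [abs_lt]; constructor <;> omega)]
  rcases eq_or_ne a c with h | h
  · subst h
    have : ((-1 : ℝ)) ^ (((a : ℕ) : ℤ) + ((a : ℕ) : ℤ) + 2) = 1 :=
      Even.neg_one_zpow ⟨((a : ℕ) : ℤ) + 1, by ring⟩
    rw [this, Matrix.one_apply_eq]
    simp
    field_simp
    ring
  · have hne : (a : ℕ) ≠ c := fun h' => h (Fin.ext h')
    rw [sum_cos k (((a : ℕ) : ℤ) - ((c : ℕ) : ℤ)) (by omega) (by rw [abs_lt]; constructor <;> omega),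
      Matrix.one_apply_ne h]
    have : ((-1 : ℝ)) ^ (((a : ℕ) : ℤ) + ((c : ℕ) : ℤ) + 2) =
        (-1) ^ (((a : ℕ) : ℤ) - ((c : ℕ) : ℤ)) := by
      rw [show ((a : ℕ) : ℤ) + ((c : ℕ) : ℤ) + 2 =
        (((a : ℕ) : ℤ) - ((c : ℕ) : ℤ)) + 2 * (((c : ℕ) : ℤ) + 1) by ring,
        zpow_add₀ (by norm_num), zpow_mul]
      norm_num
    rw [this]; ring

theorem affineS_inv (k : ℕ) : (affineS k)⁻¹ = affineS k :=
  Matrix.inv_eq_left_inv (affineS_mul_self k)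

theorem affineS_zero_pos (k : ℕ) (l : Fin (k + 1)) : 0 < affineS k 0 l := by
  have hN : (0 : ℝ) < (k : ℝ) + 2 := by positivity
  have hl : ((l : ℕ) : ℝ) + 1 < (k : ℝ) + 2 := by
    have := l.isLt
    have h : ((l : ℕ) : ℝ) < (k : ℝ) + 1 := by exact_mod_cast this
    linarith
  simp only [affineS, Matrix.of_apply]
  apply mul_pos (Real.sqrt_pos.2 (by positivity))
  apply Real.sin_pos_of_pos_of_lt_pi
  · simp only [Fin.val_zero]; have := Real.pi_pos; positivity
  · simp only [Fin.val_zero, Nat.cast_zero, zero_add, mul_one]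
    rw [div_lt_iff₀ hN]
    exact mul_lt_mul_of_pos_left hl Real.pi_pos

/-- The columns of the `S`-matrix diagonalise the fusion coefficients. -/
theorem affineFusion_mul_affineS (k : ℕ) (a b l : Fin (k + 1)) :
    (∑ c, (affineFusion k a b c : ℝ) * affineS k c l) * affineS k 0 l =
      affineS k a l * affineS k b l := by
  have hN : (0 : ℝ) < (k : ℝ) + 2 := by positivity
  set θ : ℝ := Real.pi * (((l : ℕ) : ℝ) + 1) / ((k : ℝ) + 2) with hθ
  set σ : ℝ := Real.sqrt (2 / ((k : ℝ) + 2)) with hσ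
  have hS : ∀ c : Fin (k + 1), affineS k c l = σ * Real.sin ((((c : ℕ) : ℝ) + 1) * θ) := by
    intro c
    simp only [affineS, Matrix.of_apply]
    congr 2; rw [hθ]; ring
  have ha := a.isLt
  have hb := b.isLt
  have hl := l.isLt
  -- the summation over `c = d + 2 j`
  obtain ⟨d, J, hd, hdJ, hmem⟩ : ∃ d J : ℕ, ((d : ℤ) = (a : ℕ) - (b : ℕ) ∨
      (d : ℤ) = (b : ℕ) - (a : ℕ)) ∧ (d + 2 * J = a + b ∨ d + 2 * J + (a + b) = 2 * k) ∧
      ∀ c : ℕ, ((a : ℕ) ≤ b + c ∧ (b : ℕ) ≤ a + c ∧ c ≤ a + b ∧ (a + b + c : ℕ) ≤ 2 * k ∧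
        (a + b + c : ℕ) % 2 = 0) ↔ ∃ j < J + 1, d + 2 * j = c := by
    refine ⟨((a : ℕ) - b) + ((b : ℕ) - a), min (min (a : ℕ) b) (k - max (a : ℕ) b),
      by omega, by omega, ?_⟩
    intro c
    constructor
    · intro h
      exact ⟨(c - (((a : ℕ) - b) + ((b : ℕ) - a))) / 2, by omega, by omega⟩
    · rintro ⟨j, hj, rfl⟩
      omega
  have hsum : ∑ c, (affineFusion k a b c : ℝ) * affineS k c l =
      ∑ j ∈ Finset.range (J + 1), σ * Real.sin (((d + 2 * j : ℕ) + 1 : ℝ) * θ) := by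
    simp_rw [hS]
    have h1 : ∀ c : Fin (k + 1), (affineFusion k a b c : ℝ) *
        (σ * Real.sin ((((c : ℕ) : ℝ) + 1) * θ)) =
        (fun c : ℕ => if ∃ j < J + 1, d + 2 * j = c then
          σ * Real.sin (((c : ℝ) + 1) * θ) else 0) c := by
      intro c
      simp only [affineFusion, hmem]
      split_ifs <;> simp
    rw [Finset.sum_congr rfl fun c _ => h1 c, Fin.sum_univ_eq_sum_range
      (fun c : ℕ => if ∃ j < J + 1, d + 2 * j = c then
          σ * Real.sin (((c : ℝ) + 1) * θ) else 0) (k + 1), ← Finset.sum_filter]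
    symm
    refine Finset.sum_bij (fun j _ => d + 2 * j) ?_ ?_ ?_ ?_
    · intro j hj
      rw [Finset.mem_range] at hj
      rw [Finset.mem_filter, Finset.mem_range]
      have hc := (hmem (d + 2 * j)).2 ⟨j, hj, rfl⟩
      exact ⟨by omega, j, hj, rfl⟩
    · intro i _ j _ h
      omega
    · intro c hc
      rw [Finset.mem_filter] at hc
      obtain ⟨_, j, hj, hjc⟩ := hc
      exact ⟨j, Finset.mem_range.2 hj, hjc⟩
    · intro j _; rfl
  have htel : ∀ n : ℕ, 2 * Real.sin θ * ∑ j ∈ Finset.range n,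
      σ * Real.sin (((d + 2 * j : ℕ) + 1 : ℝ) * θ) =
      σ * (Real.cos (d * θ) - Real.cos ((d + 2 * n : ℝ) * θ)) := by
    intro n
    induction n with
    | zero => simp
    | succ n ih =>
      rw [Finset.sum_range_succ, mul_add, ih]
      have e1 : Real.cos ((d + 2 * n : ℝ) * θ) =
          Real.cos (((d + 2 * n : ℕ) + 1 : ℝ) * θ - θ) := by congr 1; push_cast; ring
      have e2 : Real.cos ((d + 2 * (n + 1 : ℕ) : ℝ) * θ) =
          Real.cos (((d + 2 * n : ℕ) + 1 : ℝ) * θ + θ) := by congr 1; push_cast; ring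
      rw [e1, e2, Real.cos_sub, Real.cos_add]
      ring
  have hcosd : Real.cos (d * θ) = Real.cos ((((a : ℕ) : ℝ) + 1) * θ - (((b : ℕ) : ℝ) + 1) * θ) := by
    rcases hd with h | h
    · have h' : (d : ℝ) = (a : ℕ) - (b : ℕ) := by exact_mod_cast h
      rw [h']; congr 1; ring
    · have h' : (d : ℝ) = (b : ℕ) - (a : ℕ) := by exact_mod_cast h
      rw [h', ← Real.cos_neg]; congr 1; ring
  have hcosJ : Real.cos ((d + 2 * (J + 1 : ℕ) : ℝ) * θ) =
      Real.cos ((((a : ℕ) : ℝ) + 1) * θ + (((b : ℕ) : ℝ) + 1) * θ) := by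
    rcases hdJ with h | h
    · have h' : (d : ℝ) + 2 * J = (a : ℕ) + (b : ℕ) := by exact_mod_cast h
      congr 1; push_cast
      linear_combination θ * h'
    · have h' : (d : ℝ) + 2 * J + ((a : ℕ) + (b : ℕ)) = 2 * k := by exact_mod_cast h
      have h'' : (d + 2 * (J + 1 : ℕ) : ℝ) * θ = ((l : ℕ) + 1 : ℕ) * (2 * Real.pi) -
          ((((a : ℕ) : ℝ) + 1) * θ + (((b : ℕ) : ℝ) + 1) * θ) := by
        have hθ2 : θ * ((k : ℝ) + 2) = Real.pi * (((l : ℕ) : ℝ) + 1) := by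
          rw [hθ]; field_simp
        push_cast
        linear_combination θ * h' + 2 * hθ2
      rw [h'', Real.cos_nat_mul_two_pi_sub]
  have h0 : affineS k 0 l = σ * Real.sin θ := by rw [hS]; simp
  rw [hsum, h0, hS, hS]
  have h := htel (J + 1)
  rw [hcosd, hcosJ, Real.cos_sub, Real.cos_add] at h
  linear_combination (σ / 2) * h

/-- The Verlinde formula for `A_1^(1)` at level `k`. -/
theorem affineFusion_eq_verlinde (k : ℕ) (a b c : Fin (k + 1)) :
    (affineFusion k a b c : ℝ) =
      ∑ l, affineS k a l * affineS k b l * (affineS k)⁻¹ l c / affineS k 0 l := by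
  rw [affineS_inv]
  have h : ∀ l, affineS k a l * affineS k b l * affineS k l c / affineS k 0 l =
      ∑ c', (affineFusion k a b c' : ℝ) * (affineS k c' l * affineS k l c) := by
    intro l
    rw [← affineFusion_mul_affineS]
    have := (affineS_zero_pos k l).ne'
    have e : ∀ X : ℝ, X * affineS k 0 l * affineS k l c / affineS k 0 l = X * affineS k l c := by
      intro X
      field_simp
    rw [e, Finset.sum_mul]
    exact Finset.sum_congr rfl fun _ _ => by ring
  rw [Finset.sum_congr rfl fun l _ => h l, Finset.sum_comm]
  simp_rw [← Finset.mul_sum, ← Matrix.mul_apply, affineS_mul_self]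
  simp [Matrix.one_apply]

namespace AffineFusionRing

/-- The generalised quantum dimensions `[a] ↦ S_{al} / S_{0l}`. -/
noncomputable def chi (k : ℕ) (x : AffineFusionRing k) (l : Fin (k + 1)) : ℝ :=
  ∑ a, (x a : ℝ) * (affineS k a l / affineS k 0 l)

theorem chi_add (k : ℕ) (x y : AffineFusionRing k) : chi k (x + y) = chi k x + chi k y := by
  funext l
  have h : ∀ a, (x + y) a = x a + y a := fun a => rfl
  simp [chi, h, add_mul, Finset.sum_add_distrib]

theorem chi_cls (k : ℕ) (a l : Fin (k + 1)) :
    chi k (cls k a) l = affineS k a l / affineS k 0 l := by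
  have h : ∀ b, cls k a b = if b = a then 1 else 0 := fun b => by
    simp [cls, Pi.single_apply]
  simp [chi, h]

theorem chi_one (k : ℕ) : chi k 1 = 1 := by
  funext l
  exact (chi_cls k 0 l).trans (div_self (affineS_zero_pos k l).ne')

theorem chi_mul (k : ℕ) (x y : AffineFusionRing k) : chi k (x * y) = chi k x * chi k y := by
  funext l
  have h0 := (affineS_zero_pos k l).ne'
  have key : ∀ a b, ∑ c, (affineFusion k a b c : ℝ) * (affineS k c l / affineS k 0 l) =
      (affineS k a l / affineS k 0 l) * (affineS k b l / affineS k 0 l) := by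
    intro a b
    have h := affineFusion_mul_affineS k a b l
    have h2 : ∑ c, (affineFusion k a b c : ℝ) * (affineS k c l / affineS k 0 l) =
        (∑ c, (affineFusion k a b c : ℝ) * affineS k c l) / affineS k 0 l := by
      rw [Finset.sum_div]
      exact Finset.sum_congr rfl fun _ _ => by ring
    rw [h2]
    field_simp
    linear_combination h
  simp only [chi, Pi.mul_apply, mul_apply, Int.cast_sum, Int.cast_mul]
  simp_rw [Finset.sum_mul]
  rw [Finset.sum_comm]
  refine Finset.sum_congr rfl fun a _ => ?_
  rw [Finset.sum_comm]
  rw [Finset.mul_sum]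
  refine Finset.sum_congr rfl fun b _ => ?_
  simp_rw [mul_assoc, ← Finset.mul_sum]
  rw [key]; ring

theorem chi_injective (k : ℕ) : Function.Injective (chi k) := by
  intro x y h
  have hv : ∀ l, ∑ a, (x a : ℝ) * affineS k a l = ∑ a, (y a : ℝ) * affineS k a l := by
    intro l
    have h0 := (affineS_zero_pos k l).ne'
    have hl := congrFun h l
    simp only [chi, ← mul_div_assoc] at hl
    rw [← Finset.sum_div, ← Finset.sum_div] at hl
    exact (div_left_inj' h0).1 hl
  have hv2 : Matrix.vecMul (fun a => (x a : ℝ)) (affineS k) =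
      Matrix.vecMul (fun a => (y a : ℝ)) (affineS k) := by
    funext l
    simpa [Matrix.vecMul, dotProduct] using hv l
  have hv3 := congrArg (fun v => Matrix.vecMul v (affineS k)) hv2
  simp only [Matrix.vecMul_vecMul, affineS_mul_self, Matrix.vecMul_one] at hv3
  funext a
  exact_mod_cast congrFun hv3 a

theorem chi_zero (k : ℕ) : chi k 0 = 0 := by
  have h := chi_add k 0 0
  rw [add_zero] at h
  exact left_eq_add.1 h

instance (k : ℕ) : CommRing (AffineFusionRing k) :=
  { (inferInstance : AddCommGroup (AffineFusionRing k)) with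
    mul := (· * ·)
    one := 1
    mul_assoc := fun x y z => chi_injective k (by simp only [chi_mul, mul_assoc])
    one_mul := fun x => chi_injective k (by simp only [chi_mul, chi_one, one_mul])
    mul_one := fun x => chi_injective k (by simp only [chi_mul, chi_one, mul_one])
    zero_mul := fun x => chi_injective k (by simp only [chi_mul, chi_zero, zero_mul])
    mul_zero := fun x => chi_injective k (by simp only [chi_mul, chi_zero, mul_zero])
    left_distrib := fun x y z => chi_injective k (by simp only [chi_mul, chi_add, mul_add])
    right_distrib := fun x y z => chi_injective k (by simp only [chi_mul, chi_add, add_mul])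
    mul_comm := fun x y => chi_injective k (by simp only [chi_mul, mul_comm]) }

end AffineFusionRing

end FusionFacts

/-! ## Standard and atypical modules of the singlet algebra, their regularised characters -/

namespace Singlet

/-- `α_+ = √(2 p)`, for `(p_+, p_-) = (1, p)`. -/
noncomputable def alphaPlus (p : ℕ) : ℝ := Real.sqrt (2 * p)

/-- `α_- = -√(2 / p)`. -/
noncomputable def alphaMinus (p : ℕ) : ℝ := -Real.sqrt (2 / p)

/-- `α_0 = α_+ + α_-`. -/
noncomputable def alphaZero (p : ℕ) : ℝ := alphaPlus p + alphaMinus p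

/-- The Heisenberg weight
`α_{r,s;n} = (1 - r) / 2 * α_+ + (1 - s) / 2 * α_- + n / 2 * α`, where `α = p_+ α_+ = α_+`. -/
noncomputable def weight (p : ℕ) (r s n : ℤ) : ℝ :=
  (1 - r) / 2 * alphaPlus p + (1 - s) / 2 * alphaMinus p + n / 2 * alphaPlus p

/-- The regularised character
`ch[F_λ^ε](τ) = e^{2 π ε (λ - α_0 / 2)} q^{(λ - α_0 / 2)^2 / 2} / η(τ)`, `q = e^{2 π i τ}`,
of the Fock module of weight `λ`. -/
noncomputable def fockChar (p : ℕ) (lam ε τ : ℂ) : ℂ :=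
  Complex.exp (2 * Real.pi * ε * (lam - (alphaZero p : ℂ) / 2)) *
    (Complex.exp (2 * Real.pi * Complex.I * τ * ((lam - (alphaZero p : ℂ) / 2) ^ 2 / 2)) /
      ModularForm.eta τ)

/-- The regularised character of `M_{r,s}`, where `1 ≤ s ≤ p`. For `s < p` it is obtained from the
Felder coresolution
`0 → M_{r,s} → F_{1,s;n} → F_{1,p-s;n-1} → F_{1,s;n-2} → F_{1,p-s;n-3} → ⋯`, `n = r - 1`,
by taking the alternating sum of regularised Fock characters, and `M_{r,p} = F_{1,p;r-1}`. -/
noncomputable def atypicalChar (p : ℕ) (r : ℤ) (s : ℕ) (ε τ : ℂ) : ℂ :=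
  if s = p then fockChar p (weight p 1 p (r - 1)) ε τ
  else ∑' k : ℕ,
    (fockChar p (weight p 1 s (r - 1 - 2 * k)) ε τ -
      fockChar p (weight p 1 ((p : ℤ) - s) (r - 1 - 2 * k - 1)) ε τ)

/-- Names of modules of the singlet algebra: `standard lam` is the Fock module `F_λ`, and
`atypical r s` is the irreducible module `M_{r,s}` (for `1 ≤ s ≤ p`, see `IsModule`).
Every simple module is one of these. -/
inductive Label : Type
  | standard (lam : ℂ) : Label
  | atypical (r : ℤ) (s : ℕ) : Label

/-- The labels that denote a module of the singlet algebra with parameter `p`. -/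
def IsModule (p : ℕ) : Label → Prop
  | .standard _ => True
  | .atypical _ s => 1 ≤ s ∧ s ≤ p

/-- The regularised character of a module. -/
noncomputable def regChar (p : ℕ) : Label → ℂ → ℂ → ℂ
  | .standard lam => fockChar p lam
  | .atypical r s => atypicalChar p r s

/-- The vacuum module, i.e. the singlet algebra itself. -/
def vacuum : Label := .atypical 1 1

/-- `ch[X^ε](i y) / ch[V^ε](i y)`, where `V` is the singlet algebra. -/
noncomputable def charRatio (p : ℕ) (X : Label) (ε : ℂ) (y : ℝ) : ℂ :=
  regChar p X ε (Complex.I * y) / regChar p vacuum ε (Complex.I * y)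

/-- The regularised quantum dimension `qdim[X^ε] = lim_{y → 0+} ch[X^ε](i y) / ch[V^ε](i y)`. -/
noncomputable def qdim (p : ℕ) (X : Label) (ε : ℂ) : ℂ :=
  limUnder (𝓝[>] (0 : ℝ)) (charRatio p X ε)

/-- `qdim[X^ε]` is well defined: the denominator does not vanish near `0+` and the limit exists. -/
def HasQdim (p : ℕ) (X : Label) (ε : ℂ) : Prop :=
  (∀ᶠ y : ℝ in 𝓝[>] 0, regChar p vacuum ε (Complex.I * y) ≠ 0) ∧
    ∃ d : ℂ, Tendsto (charRatio p X ε) (𝓝[>] 0) (𝓝 d)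

/-- The wall `B_ε^p = - min { |m / √(2 p) - Im ε| : m ∈ ℤ, p ∤ m }`. -/
noncomputable def wall (p : ℕ) (ε : ℂ) : ℝ :=
  -sInf {d : ℝ | ∃ m : ℤ, ¬ (p : ℤ) ∣ m ∧ d = |(m : ℝ) / Real.sqrt (2 * p) - ε.im|}

/-- The continuous regime `Re ε > B_ε^p`, `Re ε ≠ 0`. -/
def contRegime (p : ℕ) : Set ℂ := {ε | wall p ε < ε.re ∧ ε.re ≠ 0}

/-- The discrete regime `Re ε < B_ε^p`, without the horizontal lines on which the minimum in the
definition of `B_ε^p` is attained twice. -/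
def discRegime (p : ℕ) : Set ℂ :=
  {ε | ε.re < wall p ε ∧
    ∃! m : ℤ, ¬ (p : ℤ) ∣ m ∧ |(m : ℝ) / Real.sqrt (2 * p) - ε.im| = -wall p ε}

/-- The space of quantum dimensions on `U`: the additive group of functions on `U` generated by
`ε ↦ qdim[X^ε]`, where `X` runs through the modules of the singlet algebra. -/
def qdimSpace (p : ℕ) (U : Set ℂ) : AddSubgroup (U → ℂ) :=
  AddSubgroup.closure {f | ∃ X : Label, IsModule p X ∧ f = fun ε : U => qdim p X ε}

/-- `[M_{r,l}]` if `l ≤ p`, and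
`[M_{r,2p-l}] + [M_{r+1,l-p}] + [M_{r-1,l-p}]` if `p < l < 2 p`, as a formal sum. -/
def fusionTerm (p : ℕ) (r : ℤ) (l : ℕ) : Multiset Label :=
  if l ≤ p then {.atypical r l}
  else {.atypical r (2 * p - l), .atypical (r + 1) (l - p), .atypical (r - 1) (l - p)}

/-- The (Verlinde) product of the classes of two modules, as a formal sum of modules:
`F_λ × F_μ = ∑_{j=0}^{p-1} F_{λ+μ+jα_-}`, `M_{r,s} × F_μ = ∑_{j=0}^{s-1} F_{μ+α_{1,s-2j;r-1}}`, and
`M_{r,s} × M_{r',s'} = ∑_l [M_{r+r'-1,l}]` over `l = s+s'-1, s+s'-3, …, |s-s'|+1`, where the terms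
with `l > p` are to be read as in `fusionTerm`. -/
noncomputable def fusion (p : ℕ) : Label → Label → Multiset Label
  | .standard lam, .standard mu =>
      (Multiset.range p).map fun j => .standard (lam + mu + j * (alphaMinus p : ℂ))
  | .atypical r s, .standard mu =>
      (Multiset.range s).map fun j => .standard (mu + (weight p 1 ((s : ℤ) - 2 * j) (r - 1) : ℂ))
  | .standard lam, .atypical r s =>
      (Multiset.range s).map fun j => .standard (lam + (weight p 1 ((s : ℤ) - 2 * j) (r - 1) : ℂ))
  | .atypical r s, .atypical r' s' =>
      (Multiset.range (min s s')).bind fun j => fusionTerm p (r + r' - 1) (s + s' - 1 - 2 * j)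

end Singlet

/-! After multiplication by `η` and at `τ = iy`, every character becomes a sum of Gaussians. With `h
= 1/√(2p)`, the Fock modules resolving `M_{r,s}` have shifted weights in `hℤ`, so for `s < p` the
numerator is a difference of two partial theta series, and the question is how these behave as `y →
0+`.

If `Re ε > 0`, the partial series converge to geometric series, and their difference tends to
`e^{u(r-1)p} sinh(us)/sinh(up)` with `u = 2πεh`. If `Re ε < 0`, each partial series is completed to
a full one; the missing half is a partial series for `-ε`, which converges, and it contributes the
same closed form. By Poisson summation the difference of the full series is `(2py)^{-1/2} ∑ c_n
exp(π(ε - inh)²/y)`, where `c_n` contains the factor `sinh(iπns/p)` and hence vanishes for `p ∣ n`.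
The exponent has real part `π((Re ε)² - (nh - Im ε)²)/y`, so the wall decides between decay and
growth. Beyond the wall the unique nearest `m` dominates everything else, and the quantum dimension
is a ratio of coefficients `c_m`.

Both regimes thus give `e^{u(r-1)p} sinh(us)/sinh(u)` for `M_{r,s}`, with `u = 2πεh` or `u = iπm/p`;
in the latter case Fock modules have dimension `0` (`dimVal`). Multiplicativity is then the
Clebsch–Gordan identity for `sinh` (`dimVal_mul`).

On the discrete regime, `M_{1,a+1}` has dimension `sin(πm(a+1)/p)/sin(πm/p) = S_{al}/S_{0l}`, where
`l + 1` represents `±m` modulo `2p`. Every column `l` occurs and `S² = 1`, which gives linear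
independence and the isomorphism; the remaining modules contribute only zero or `±` these functions.
-/

namespace Singlet

/-! ### Partial theta series and their geometric limits -/

/-- The term `e^{2 π ε h x} q^{(h x)^2 / 2}` of a regularised character, at `q = e^{-2 π y}`. -/
noncomputable def gauss (h : ℝ) (ε : ℂ) (y : ℝ) (x : ℤ) : ℂ :=
  Complex.exp (2 * Real.pi * ε * h * x - Real.pi * y * h ^ 2 * x ^ 2)

theorem gauss_neg (h : ℝ) (ε : ℂ) (y : ℝ) (x : ℤ) : gauss h (-ε) y (-x) = gauss h ε y x := by
  unfold gauss
  congr 1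
  push_cast
  ring

theorem norm_gauss_le (h : ℝ) (ε : ℂ) {y : ℝ} (hy : 0 ≤ y) (x : ℤ) :
    ‖gauss h ε y x‖ ≤ Real.exp (2 * Real.pi * ε.re * h * x) := by
  have e : (2 * Real.pi * ε * h * x - Real.pi * y * h ^ 2 * x ^ 2 : ℂ) =
      ((2 * Real.pi * h * x : ℝ) : ℂ) * ε - ((Real.pi * y * h ^ 2 * x ^ 2 : ℝ) : ℂ) := by
    push_cast; ring
  rw [gauss, Complex.norm_exp, e, Complex.sub_re, Complex.re_ofReal_mul, Complex.ofReal_re]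
  apply Real.exp_le_exp.2
  have : 0 ≤ Real.pi * y * h ^ 2 * (x : ℝ) ^ 2 := by positivity
  linarith

theorem tendsto_gauss (h : ℝ) (ε : ℂ) (x : ℤ) :
    Tendsto (fun y => gauss h ε y x) (𝓝[>] 0) (𝓝 (Complex.exp (2 * Real.pi * ε * h * x))) := by
  have : Continuous fun y => gauss h ε y x := by unfold gauss; fun_prop
  have h2 := this.tendsto 0
  simp only [gauss, Complex.ofReal_zero, mul_zero, zero_mul, sub_zero] at h2
  exact h2.mono_left nhdsWithin_le_nhds

/-- The limit of a partial theta series on its half plane of convergence. -/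
theorem tendsto_tsum_gauss_sub {h : ℝ} (hh : 0 < h) {p : ℕ} (hp : 0 < p) {ε : ℂ}
    (hε : 0 < ε.re) (x : ℤ) :
    Tendsto (fun y => ∑' k : ℕ, gauss h ε y (x - 2 * p * k)) (𝓝[>] 0)
      (𝓝 (Complex.exp (2 * Real.pi * ε * h * x) /
        (1 - Complex.exp (-(2 * Real.pi * ε * h) * (2 * p))))) := by
  set c := 2 * Real.pi * ε.re * h with hc
  have hc0 : 0 < c := by have := Real.pi_pos; positivity
  have hp' : (0 : ℝ) < p := by exact_mod_cast hp
  have hnorm : ‖Complex.exp (-(2 * Real.pi * ε * h) * (2 * p))‖ < 1 := by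
    have e : (-(2 * Real.pi * ε * h) * (2 * p) : ℂ) =
      ((-(2 * Real.pi * h * (2 * p)) : ℝ) : ℂ) * ε := by push_cast; ring
    rw [Complex.norm_exp, e, Complex.re_ofReal_mul, Real.exp_lt_one_iff]
    have := Real.pi_pos
    have : 0 < 2 * Real.pi * h * (2 * p) * ε.re := by positivity
    linarith
  have hlim : ∑' k : ℕ, Complex.exp (2 * Real.pi * ε * h * ((x - 2 * p * k : ℤ) : ℂ)) =
      Complex.exp (2 * Real.pi * ε * h * x) /
        (1 - Complex.exp (-(2 * Real.pi * ε * h) * (2 * p))) := by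
    rw [div_eq_mul_inv, ← tsum_geometric_of_norm_lt_one hnorm, ← tsum_mul_left]
    refine tsum_congr fun k => ?_
    rw [← Complex.exp_nat_mul, ← Complex.exp_add]
    congr 1
    push_cast
    ring
  rw [← hlim]
  have hr : Real.exp (-(c * (2 * p))) < 1 := by
    rw [Real.exp_lt_one_iff]
    have : 0 < c * (2 * p) := by positivity
    linarith
  -- The Gaussian factor is at most `1`, so the geometric series at `y = 0` dominates.
  refine tendsto_tsum_of_dominated_convergence
    (bound := fun k : ℕ => Real.exp (c * x) * Real.exp (-(c * (2 * p))) ^ k)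
    ((summable_geometric_of_lt_one (Real.exp_pos _).le hr).mul_left _)
    (fun k => tendsto_gauss h ε _) ?_
  filter_upwards [self_mem_nhdsWithin] with y hy k
  refine (norm_gauss_le h ε (le_of_lt hy) _).trans_eq ?_
  rw [← Real.exp_nat_mul, ← Real.exp_add]
  congr 1
  push_cast
  ring

/-! ### Full theta series and Poisson summation -/

theorem summable_gauss {h : ℝ} (hh : 0 < h) {p : ℕ} (hp : 0 < p) (ε : ℂ) {y : ℝ} (hy : 0 < y)
    (x : ℤ) : Summable fun k : ℤ => gauss h ε y (x - 2 * p * k) := by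
  have hp' : (0 : ℝ) < p := by exact_mod_cast hp
  have hτ : 0 < (Complex.I * ((4 * p ^ 2 * h ^ 2 * y : ℝ) : ℂ)).im := by
    rw [Complex.I_mul_im, Complex.ofReal_re]; positivity
  have := ((summable_jacobiTheta₂_term_iff
    (Complex.I * (2 * p * ε * h - 2 * p * x * h ^ 2 * y)) _).2 hτ).mul_left
    (gauss h ε y x)
  refine this.congr fun k => ?_
  rw [gauss, gauss, jacobiTheta₂_term, ← Complex.exp_add]
  congr 1
  push_cast
  linear_combination (2 * Real.pi * k * (2 * p * ε * h - 2 * p * x * h ^ 2 * y) +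
    Real.pi * k ^ 2 * (4 * p ^ 2 * h ^ 2 * y)) * Complex.I_sq

/-- Poisson summation for the theta series. -/
theorem tsum_gauss {h : ℝ} {p : ℕ} (hp : 0 < p) (hph : h ^ 2 * (2 * p) = 1) (ε : ℂ) {y : ℝ}
    (hy : 0 < y) (x : ℤ) :
    ∑' k : ℤ, gauss h ε y (x - 2 * p * k) =
      1 / (2 * p * y : ℂ) ^ (1 / 2 : ℂ) * ∑' n : ℤ,
        Complex.exp (Complex.I * Real.pi * x * n / p) *
          Complex.exp (Real.pi * (ε - Complex.I * n * h) ^ 2 / y) := by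
  have hp' : (p : ℂ) ≠ 0 := by exact_mod_cast hp.ne'
  have hy' : (y : ℂ) ≠ 0 := by exact_mod_cast hy.ne'
  have hph' : (h : ℂ) ^ 2 * (2 * p) = 1 := by exact_mod_cast congrArg (fun t : ℝ => (t : ℂ)) hph
  have hre : 0 < (2 * p * y : ℂ).re := by
    have : (2 * p * y : ℂ) = ((2 * p * y : ℝ) : ℂ) := by push_cast; ring
    rw [this, Complex.ofReal_re]
    have : (0 : ℝ) < p := by exact_mod_cast hp
    positivity
  -- Expanding the square in `gauss` at `x - 2pk` with `2ph² = 1` leaves a quadratic coefficient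
  -- `2py` and this linear coefficient in `k`.
  have key := Complex.tsum_exp_neg_quadratic hre (y * x - 2 * p * h * ε)
  have h1 : ∑' k : ℤ, gauss h ε y (x - 2 * p * k) = gauss h ε y x *
      ∑' k : ℤ, Complex.exp (-Real.pi * (2 * p * y) * k ^ 2 +
        2 * Real.pi * (y * x - 2 * p * h * ε) * k) := by
    rw [← tsum_mul_left]
    refine tsum_congr fun k => ?_
    rw [gauss, gauss, ← Complex.exp_add]
    congr 1
    push_cast
    linear_combination (2 * Real.pi * y * x * k - Real.pi * y * 2 * p * k ^ 2) * hph'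
  rw [h1, key, mul_left_comm, ← tsum_mul_left, ← (Equiv.neg ℤ).tsum_eq]
  congr 1
  refine tsum_congr fun n => ?_
  rw [gauss, ← Complex.exp_add, ← Complex.exp_add]
  congr 1
  -- Eliminating `p` in favour of `h` turns the comparison of exponents into an identity of rational
  -- functions.
  have e : (p : ℂ) = 1 / (2 * h ^ 2) := by
    have : (h : ℂ) ≠ 0 := by rintro h0; simp [h0] at hph'
    field_simp
    linear_combination hph'
  have hh : (h : ℂ) ≠ 0 := by rintro h0; simp [h0] at hph'
  simp only [Equiv.neg_apply]
  push_cast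
  rw [e]
  field_simp
  ring_nf
  simp only [Complex.I_sq]
  ring

/-- Domination of exponential sums with quadratic phases, as `y → 0+`. -/
theorem tendsto_tsum_exp_div {z a : ℤ → ℂ} {w : ℂ} {C : ℝ} (ha : ∀ n, ‖a n‖ ≤ C)
    (hz : Summable fun n => Complex.exp (Real.pi * z n))
    (h : ∀ n, a n = 0 ∨ (z n).re < w.re ∨ z n = w) :
    Tendsto (fun y : ℝ => ∑' n, a n * Complex.exp (Real.pi * (z n - w) / y)) (𝓝[>] 0)
      (𝓝 (∑' n, if z n = w then a n else 0)) := by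
  have hC : 0 ≤ C := (norm_nonneg _).trans (ha 0)
  have hnorm : ∀ (n : ℤ) (y : ℝ), ‖Complex.exp (Real.pi * (z n - w) / y)‖ =
      Real.exp (Real.pi * ((z n).re - w.re) * y⁻¹) := by
    intro n y
    have e : (Real.pi * (z n - w) / y : ℂ) = ((Real.pi * y⁻¹ : ℝ) : ℂ) * (z n - w) := by
      push_cast; ring
    rw [Complex.norm_exp, e, Complex.re_ofReal_mul, Complex.sub_re]
    congr 1; ring
  refine tendsto_tsum_of_dominated_convergence
    (bound := fun n => C * (Real.exp (-(Real.pi * w.re)) * ‖Complex.exp (Real.pi * z n)‖))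
    ((hz.norm.mul_left _).mul_left _) ?_ ?_
  · intro n
    rcases h n with h | h | h
    · simp [h]
    · have hne : z n ≠ w := fun h' => by rw [h'] at h; exact lt_irrefl _ h
      rw [if_neg hne, tendsto_zero_iff_norm_tendsto_zero]
      simp only [norm_mul, hnorm]
      have hlim := (Real.tendsto_exp_atBot.comp (tendsto_inv_nhdsGT_zero.const_mul_atTop_of_neg
        (mul_neg_of_pos_of_neg Real.pi_pos (sub_neg.2 h)))).const_mul ‖a n‖
      rwa [mul_zero] at hlim
    · simp [h]
  -- For `y ≤ 1` and nonpositive real part of `z n - w`, replacing `1/y` by `1` only enlarges the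
  -- term, so the summable series at `y = 1` dominates.
  · have h1 : ∀ᶠ y : ℝ in 𝓝[>] 0, y ∈ Set.Ioc (0 : ℝ) 1 :=
      Ioc_mem_nhdsGT one_pos
    filter_upwards [h1] with y hy n
    rcases eq_or_ne (a n) 0 with h0 | h0
    · rw [h0, zero_mul, norm_zero]; positivity
    rw [norm_mul, hnorm]
    refine mul_le_mul (ha n) ?_ (Real.exp_pos _).le hC
    rw [Complex.norm_exp, Complex.re_ofReal_mul, ← Real.exp_add]
    apply Real.exp_le_exp.2
    have hle : (z n).re - w.re ≤ 0 := by
      rcases h n with h | h | h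
      · exact absurd h h0
      · linarith
      · rw [h]; simp
    have hy1 : 1 ≤ y⁻¹ := (one_le_inv₀ hy.1).2 hy.2
    nlinarith [mul_nonneg (mul_nonneg Real.pi_pos.le (neg_nonneg.2 hle)) (sub_nonneg.2 hy1)]

theorem summable_exp_sq {h : ℝ} (hh : 0 < h) (ε : ℂ) :
    Summable fun n : ℤ => Complex.exp (Real.pi * (ε - Complex.I * n * h) ^ 2) := by
  have hτ : 0 < (Complex.I * ((h ^ 2 : ℝ) : ℂ)).im := by
    rw [Complex.I_mul_im, Complex.ofReal_re]; positivity
  refine (((summable_jacobiTheta₂_term_iff (-ε * h) _).2 hτ).mul_left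
    (Complex.exp (Real.pi * ε ^ 2))).congr fun n => ?_
  rw [jacobiTheta₂_term, ← Complex.exp_add]
  congr 1
  push_cast
  linear_combination 0 * Complex.I_sq

theorem tsum_nat_eq_tsum_int_sub {f : ℤ → ℂ} (hf : Summable f) :
    ∑' k : ℕ, f k = ∑' k : ℤ, f k - ∑' k : ℕ, f (-(k + 1)) := by
  rw [tsum_of_nat_of_neg_add_one (hf.comp_injective Nat.cast_injective)
    (hf.comp_injective (i := fun k : ℕ => -((k : ℤ) + 1)) fun a b hab => by simpa using hab),
    add_sub_cancel_right]

/-- The terms with negative index form a partial theta series again, with `ε` and `x` reflected.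
This trades a series for `Re ε < 0` for one that converges as `y → 0+`. -/
theorem tsum_gauss_nat {h : ℝ} (hh : 0 < h) {p : ℕ} (hp : 0 < p) (ε : ℂ) {y : ℝ} (hy : 0 < y)
    (x : ℤ) : ∑' k : ℕ, gauss h ε y (x - 2 * p * k) = ∑' k : ℤ, gauss h ε y (x - 2 * p * k) -
      ∑' k : ℕ, gauss h (-ε) y (-x - 2 * p - 2 * p * k) := by
  rw [tsum_nat_eq_tsum_int_sub (summable_gauss hh hp ε hy x)]
  congr 1
  refine tsum_congr fun k => ?_
  rw [← gauss_neg]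
  congr 1
  ring

/-! ### Atypical characters as partial theta series plus a theta correction -/

/-- `η` times the regularised character of `M_{r,s}` at `τ = i y`, for `s < p`. -/
noncomputable def atypSum (h : ℝ) (p : ℕ) (r s : ℤ) (ε : ℂ) (y : ℝ) : ℂ :=
  ∑' k : ℕ, gauss h ε y (s + (r - 2) * p - 2 * p * k) -
    ∑' k : ℕ, gauss h ε y (-s + (r - 2) * p - 2 * p * k)

/-- The difference of two full theta series. -/
noncomputable def thetaDiff (h : ℝ) (p : ℕ) (r s : ℤ) (ε : ℂ) (y : ℝ) : ℂ :=
  ∑' k : ℤ, gauss h ε y (s + (r - 2) * p - 2 * p * k) -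
    ∑' k : ℤ, gauss h ε y (-s + (r - 2) * p - 2 * p * k)

theorem one_sub_exp_ne_zero {v : ℂ} (hv : v.re ≠ 0) : 1 - Complex.exp v ≠ 0 := by
  intro h
  have h2 : ‖Complex.exp v‖ = 1 := by rw [← sub_eq_zero.1 h]; simp
  rw [Complex.norm_exp, Real.exp_eq_one_iff] at h2
  exact hv h2

/-- The difference of the two geometric limits, put in symmetric form by extracting `e^{up}` from
the denominator. -/
theorem exp_sub_exp_div (u : ℂ) (p : ℕ) (r s : ℤ) :
    (Complex.exp (u * (s + (r - 2) * p)) - Complex.exp (u * (-s + (r - 2) * p))) /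
      (1 - Complex.exp (-u * (2 * p))) =
      Complex.exp (u * ((r - 1) * p)) * Complex.sinh (u * s) / Complex.sinh (u * p) := by
  have e1 : Complex.sinh (u * p) =
      Complex.exp (u * p) * (1 - Complex.exp (-u * (2 * p))) / 2 := by
    rw [Complex.sinh, mul_sub, ← Complex.exp_add]
    congr 3 <;> ring
  have e2 : Complex.exp (u * (s + (r - 2) * p)) - Complex.exp (u * (-s + (r - 2) * p)) =
      Complex.exp (u * ((r - 1) * p)) * (2 * Complex.sinh (u * s)) * Complex.exp (-(u * p)) := by
    rw [Complex.sinh, mul_div_cancel₀ _ two_ne_zero, mul_sub (Complex.exp _),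
      sub_mul _ _ (Complex.exp _), ← Complex.exp_add, ← Complex.exp_add, ← Complex.exp_add, ← Complex.exp_add]
    congr 2 <;> ring
  rw [e1, e2, Complex.exp_neg]
  have := Complex.exp_ne_zero (u * p)
  field_simp

theorem tendsto_atypSum_of_pos {h : ℝ} (hh : 0 < h) {p : ℕ} (hp : 0 < p) {ε : ℂ}
    (hε : 0 < ε.re) (r s : ℤ) :
    Tendsto (atypSum h p r s ε) (𝓝[>] 0) (𝓝 (Complex.exp (2 * Real.pi * ε * h * ((r - 1) * p)) *
      Complex.sinh (2 * Real.pi * ε * h * s) / Complex.sinh (2 * Real.pi * ε * h * p))) := by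
  have := (tendsto_tsum_gauss_sub hh hp hε (s + (r - 2) * p)).sub
    (tendsto_tsum_gauss_sub hh hp hε (-s + (r - 2) * p))
  rw [← sub_div] at this
  push_cast at this
  rwa [exp_sub_exp_div] at this

/-- Reflecting both partial series interchanges them, and what remains is exactly `atypSum` at `(-ε,
2 - r)`. The limit for positive real part is invariant under `(ε, r) ↦ (-ε, 2 - r)`. -/
theorem tendsto_atypSum_sub_thetaDiff {h : ℝ} (hh : 0 < h) {p : ℕ} (hp : 0 < p) {ε : ℂ}
    (hε : ε.re < 0) (r s : ℤ) :
    Tendsto (fun y => atypSum h p r s ε y - thetaDiff h p r s ε y) (𝓝[>] 0)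
      (𝓝 (Complex.exp (2 * Real.pi * ε * h * ((r - 1) * p)) *
      Complex.sinh (2 * Real.pi * ε * h * s) / Complex.sinh (2 * Real.pi * ε * h * p))) := by
  have h1 := tendsto_atypSum_of_pos hh hp (ε := -ε) (by simpa using hε) (2 - r) s
  have e : (Complex.exp (2 * Real.pi * -ε * h * (((2 - r : ℤ) - 1) * p)) *
      Complex.sinh (2 * Real.pi * -ε * h * s) / Complex.sinh (2 * Real.pi * -ε * h * p)) =
      (Complex.exp (2 * Real.pi * ε * h * ((r - 1) * p)) *
      Complex.sinh (2 * Real.pi * ε * h * s) / Complex.sinh (2 * Real.pi * ε * h * p)) := by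
    simp only [mul_neg, neg_mul, Complex.sinh_neg, neg_div_neg_eq]
    congr 3
    push_cast; ring
  rw [e] at h1
  refine h1.congr' ?_
  filter_upwards [self_mem_nhdsWithin] with y hy
  rw [atypSum, atypSum, thetaDiff, tsum_gauss_nat hh hp ε hy, tsum_gauss_nat hh hp ε hy]
  have e1 : (-(s + (r - 2) * p) - 2 * p : ℤ) = -s + (2 - r - 2) * p := by ring
  have e2 : (-(-s + (r - 2) * p) - 2 * p : ℤ) = s + (2 - r - 2) * p := by ring
  rw [e1, e2]
  ring

/-! ### Asymptotics of the theta correction -/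

/-- The Fourier coefficient of `thetaDiff`. -/
noncomputable def thetaCoeff (p : ℕ) (r s n : ℤ) : ℂ :=
  Complex.exp (Complex.I * Real.pi * n / p * ((r - 2) * p)) *
    (2 * Complex.sinh (Complex.I * Real.pi * n / p * s))

theorem thetaCoeff_eq (p : ℕ) (r s n : ℤ) : thetaCoeff p r s n =
    Complex.exp (Complex.I * Real.pi * (s + (r - 2) * p : ℤ) * n / p) -
      Complex.exp (Complex.I * Real.pi * (-s + (r - 2) * p : ℤ) * n / p) := by
  rw [thetaCoeff, Complex.sinh, mul_div_cancel₀ _ two_ne_zero, mul_sub, ← Complex.exp_add,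
    ← Complex.exp_add]
  congr 2 <;> push_cast <;> ring

theorem norm_thetaCoeff_le (p : ℕ) (r s n : ℤ) : ‖thetaCoeff p r s n‖ ≤ 2 := by
  have h : ∀ x : ℤ, ‖Complex.exp (Complex.I * Real.pi * x * n / p)‖ = 1 := by
    intro x
    rw [show (Complex.I * Real.pi * x * n / p : ℂ) = ((Real.pi * x * n / p : ℝ) : ℂ) * Complex.I by
      push_cast; ring, Complex.norm_exp_ofReal_mul_I]
  rw [thetaCoeff_eq]
  refine (norm_sub_le _ _).trans ?_
  rw [h, h]
  norm_num

theorem sinh_I_mul_pi_int (n : ℤ) : Complex.sinh (Complex.I * Real.pi * n) = 0 := by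
  rw [show Complex.I * Real.pi * n = (n * Real.pi : ℂ) * Complex.I by ring, Complex.sinh_mul_I,
    Complex.sin_int_mul_pi, zero_mul]

/-- This vanishing is why multiples of `p` are left out of the minimum defining the wall. -/
theorem thetaCoeff_eq_zero {p : ℕ} (hp : 0 < p) (r s : ℤ) {n : ℤ} (hn : (p : ℤ) ∣ n) :
    thetaCoeff p r s n = 0 := by
  obtain ⟨j, rfl⟩ := hn
  have hp' : (p : ℂ) ≠ 0 := by exact_mod_cast hp.ne'
  have e : Complex.I * Real.pi * ((p * j : ℤ) : ℂ) / p * s =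
      Complex.I * Real.pi * ((j * s : ℤ) : ℂ) := by
    push_cast; field_simp
  rw [thetaCoeff, e, sinh_I_mul_pi_int, mul_zero, mul_zero]

/-- Poisson summation with the exponent normalised by a free `w`, to be chosen as a bound for the
exponents or as the dominant one. -/
theorem thetaDiff_eq {h : ℝ} (hh : 0 < h) {p : ℕ} (hp : 0 < p) (hph : h ^ 2 * (2 * p) = 1)
    (r s : ℤ) (ε : ℂ) {y : ℝ} (hy : 0 < y) (w : ℂ) :
    (Real.sqrt (2 * p * y) : ℂ) * Complex.exp (-(Real.pi * w / y)) * thetaDiff h p r s ε y =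
      ∑' n : ℤ, thetaCoeff p r s n *
        Complex.exp (Real.pi * ((ε - Complex.I * n * h) ^ 2 - w) / y) := by
  have hp' : (0 : ℝ) < p := by exact_mod_cast hp
  have hy' : (y : ℂ) ≠ 0 := by exact_mod_cast hy.ne'
  have hsq : (2 * p * y : ℂ) ^ (1 / 2 : ℂ) = (Real.sqrt (2 * p * y) : ℂ) := by
    rw [Real.sqrt_eq_rpow, Complex.ofReal_cpow (by positivity)]
    push_cast
    rfl
  have hne : (Real.sqrt (2 * p * y) : ℂ) ≠ 0 := by
    exact_mod_cast (Real.sqrt_pos.2 (by positivity)).ne'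
  have hS : Summable fun n : ℤ => Complex.exp (Real.pi * (ε - Complex.I * n * h) ^ 2 / y) := by
    -- Dividing by `y` amounts to rescaling both `h` and `ε` by `1/√y`.
    have h1 := summable_exp_sq (h := h / Real.sqrt y)
      (div_pos hh (Real.sqrt_pos.2 hy)) (ε / Real.sqrt y)
    refine h1.congr fun n => ?_
    have h2 : ((Real.sqrt y : ℝ) : ℂ) ^ 2 = y := by exact_mod_cast Real.sq_sqrt hy.le
    have h3 : ((Real.sqrt y : ℝ) : ℂ) ≠ 0 := by
      exact_mod_cast (Real.sqrt_pos.2 hy).ne'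
    congr 1
    rw [← h2]
    push_cast
    field_simp
  have hT : ∀ x : ℤ, Summable fun n : ℤ => Complex.exp (Complex.I * Real.pi * x * n / p) *
      Complex.exp (Real.pi * (ε - Complex.I * n * h) ^ 2 / y) := by
    intro x
    refine Summable.of_norm_bounded hS.norm fun n => ?_
    rw [norm_mul, show (Complex.I * Real.pi * x * n / p : ℂ) =
      ((Real.pi * x * n / p : ℝ) : ℂ) * Complex.I by push_cast; ring,
      Complex.norm_exp_ofReal_mul_I, one_mul]
  rw [thetaDiff, tsum_gauss hp hph ε hy, tsum_gauss hp hph ε hy, ← mul_sub,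
    ← (hT _).tsum_sub (hT _), hsq]
  rw [mul_right_comm, ← mul_assoc, mul_one_div_cancel hne, one_mul, mul_comm, ← tsum_mul_left]
  refine tsum_congr fun n => ?_
  rw [thetaCoeff_eq, ← sub_mul, mul_left_comm, ← Complex.exp_add]
  congr 2
  ring

theorem re_sq_sub (h : ℝ) (ε : ℂ) (n : ℤ) :
    ((ε - Complex.I * n * h) ^ 2).re = ε.re ^ 2 - (n * h - ε.im) ^ 2 := by
  rw [sq, Complex.mul_re]
  simp
  ring

theorem tendsto_thetaDiff_zero {h : ℝ} (hh : 0 < h) {p : ℕ} (hp : 0 < p)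
    (hph : h ^ 2 * (2 * p) = 1) (r s : ℤ) (ε : ℂ) {d : ℝ} (hd : ε.re ^ 2 < d)
    (hm : ∀ m : ℤ, ¬ (p : ℤ) ∣ m → d ≤ (m * h - ε.im) ^ 2) :
    Tendsto (thetaDiff h p r s ε) (𝓝[>] 0) (𝓝 0) := by
  have hp' : (0 : ℝ) < p := by exact_mod_cast hp
  -- Every surviving exponent has real part at most `-2c`. Normalising by `-c` makes the series tend
  -- to `0`, and undoing this costs a factor `(2py)^{-1/2} e^{-πc/y}`, which also tends to `0`.
  set c : ℝ := (d - ε.re ^ 2) / 2 with hc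
  have hc0 : 0 < c := by rw [hc]; linarith
  have key := tendsto_tsum_exp_div (w := ((-c : ℝ) : ℂ)) (norm_thetaCoeff_le p r s)
    (summable_exp_sq hh ε) fun n => by
      by_cases hn : (p : ℤ) ∣ n
      · exact Or.inl (thetaCoeff_eq_zero hp r s hn)
      · right; left
        rw [re_sq_sub, Complex.ofReal_re]
        have := hm n hn
        linarith
  have hf : Tendsto (fun y : ℝ => (Real.sqrt (2 * p * y) : ℂ)⁻¹ *
      Complex.exp (Real.pi * ((-c : ℝ) : ℂ) / y)) (𝓝[>] 0) (𝓝 0) := by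
    have h1 : Tendsto (fun y : ℝ => (Real.sqrt (2 * p))⁻¹ *
        ((y⁻¹) ^ (1 / 2 : ℝ) * Real.exp (-(Real.pi * c) * y⁻¹))) (𝓝[>] 0) (𝓝 0) := by
      have := ((tendsto_rpow_mul_exp_neg_mul_atTop_nhds_zero (1 / 2) (Real.pi * c)
        (by have := Real.pi_pos; positivity)).comp tendsto_inv_nhdsGT_zero).const_mul
        (Real.sqrt (2 * p))⁻¹
      rwa [mul_zero] at this
    have h2 := (Complex.continuous_ofReal.tendsto 0).comp h1
    rw [Complex.ofReal_zero] at h2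
    refine h2.congr' ?_
    filter_upwards [self_mem_nhdsWithin] with y hy
    simp only [Function.comp_apply]
    rw [← Real.sqrt_eq_rpow, Real.sqrt_inv, Real.sqrt_mul (by positivity : (0 : ℝ) ≤ 2 * p) y]
    push_cast
    rw [mul_inv, mul_assoc]
    congr 3
    ring
  have h3 := hf.mul key
  rw [zero_mul] at h3
  refine h3.congr' ?_
  filter_upwards [self_mem_nhdsWithin] with y hy
  rw [← thetaDiff_eq hh hp hph r s ε hy]
  have hne : (Real.sqrt (2 * p * y) : ℂ) ≠ 0 := by
    have hy' : (0 : ℝ) < y := hy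
    exact_mod_cast (Real.sqrt_pos.2 (by positivity)).ne'
  rw [Complex.exp_neg]
  have := Complex.exp_ne_zero (Real.pi * ((-c : ℝ) : ℂ) / y)
  field_simp

/-- After division by the term of the strictly nearest `m₀`, all other surviving terms decay
exponentially. Multiples of `p` may be nearer to `Im ε`, but their coefficients vanish. -/
theorem tendsto_mul_thetaDiff {h : ℝ} (hh : 0 < h) {p : ℕ} (hp : 0 < p)
    (hph : h ^ 2 * (2 * p) = 1) (r s : ℤ) (ε : ℂ) {m₀ : ℤ}
    (hm : ∀ m : ℤ, ¬ (p : ℤ) ∣ m → m ≠ m₀ → (m₀ * h - ε.im) ^ 2 < (m * h - ε.im) ^ 2) :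
    Tendsto (fun y : ℝ => (Real.sqrt (2 * p * y) : ℂ) *
        Complex.exp (-(Real.pi * (ε - Complex.I * m₀ * h) ^ 2 / y)) * thetaDiff h p r s ε y)
      (𝓝[>] 0) (𝓝 (thetaCoeff p r s m₀)) := by
  have key := tendsto_tsum_exp_div (w := (ε - Complex.I * m₀ * h) ^ 2) (norm_thetaCoeff_le p r s)
    (summable_exp_sq hh ε) fun n => by
      by_cases hn : (p : ℤ) ∣ n
      · exact Or.inl (thetaCoeff_eq_zero hp r s hn)
      · right
        rcases eq_or_ne n m₀ with h0 | h0
        · right; rw [h0]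
        · left
          rw [re_sq_sub, re_sq_sub]
          have := hm n hn h0
          linarith
  rw [tsum_eq_single m₀, if_pos rfl] at key
  · refine key.congr' ?_
    filter_upwards [self_mem_nhdsWithin] with y hy
    rw [thetaDiff_eq hh hp hph r s ε hy]
  · intro n hn
    split_ifs with h0
    · by_contra hne
      have hn' : ¬ (p : ℤ) ∣ n := fun h' => hne (thetaCoeff_eq_zero hp r s h')
      have h1 := hm n hn' hn
      have h2 := congrArg Complex.re h0
      rw [re_sq_sub, re_sq_sub] at h2
      linarith
    · rfl

theorem tendsto_sqrt_mul_exp {w : ℂ} (hw : 0 < w.re) (p : ℕ) :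
    Tendsto (fun y : ℝ => (Real.sqrt (2 * p * y) : ℂ) * Complex.exp (-(Real.pi * w / y)))
      (𝓝[>] 0) (𝓝 0) := by
  have h1 : Tendsto (fun y : ℝ => Real.sqrt (2 * p * y)) (𝓝[>] 0) (𝓝 0) := by
    have : Continuous fun y : ℝ => Real.sqrt (2 * p * y) := by fun_prop
    have h := this.tendsto 0
    simp only [mul_zero, Real.sqrt_zero] at h
    exact h.mono_left nhdsWithin_le_nhds
  refine squeeze_zero_norm' ?_ h1
  filter_upwards [self_mem_nhdsWithin] with y hy
  have hy' : (0 : ℝ) < y := hy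
  rw [norm_mul, Complex.norm_real, Real.norm_of_nonneg (Real.sqrt_nonneg _), Complex.norm_exp]
  refine mul_le_of_le_one_right (Real.sqrt_nonneg _) ?_
  rw [Real.exp_le_one_iff, show (-(Real.pi * w / y) : ℂ) = ((-(Real.pi / y) : ℝ) : ℂ) * w by
    push_cast; ring, Complex.re_ofReal_mul]
  have := Real.pi_pos
  have : 0 < Real.pi / y * w.re := by positivity
  linarith

/-! ### The hyperbolic identities behind the Verlinde product -/

/-- The quantum dimensions, as functions of `u` and of the weights `w` of the Fock modules. -/
noncomputable def dimVal (p : ℕ) (u : ℂ) (w : ℂ → ℂ) : Label → ℂ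
  | .standard lam => w lam * Complex.sinh (u * p) / Complex.sinh u
  | .atypical r s => Complex.exp (u * ((r - 1) * p)) * Complex.sinh (u * s) / Complex.sinh u

theorem sum_exp_mul_sinh (u : ℂ) (n : ℕ) :
    (∑ j ∈ Finset.range n, Complex.exp (u * (n - 1 - 2 * j))) * Complex.sinh u =
      Complex.sinh (u * n) := by
  -- The summand involves the number of terms; decoupling it as `A` lets the telescoping induction
  -- run.
  have h : ∀ (A : ℂ) (N : ℕ),
      (∑ j ∈ Finset.range N, Complex.exp (u * (A - 1 - 2 * j))) * Complex.sinh u =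
        (Complex.exp (u * A) - Complex.exp (u * (A - 2 * N))) / 2 := by
    intro A N
    induction N with
    | zero => simp
    | succ N ih =>
      rw [Finset.sum_range_succ, add_mul, ih, Complex.sinh, mul_div_assoc',
        mul_sub _ (Complex.exp u), ← Complex.exp_add, ← Complex.exp_add]
      have e1 : u * (A - 1 - 2 * N) + u = u * (A - 2 * N) := by ring
      have e2 : u * (A - 1 - 2 * N) + -u = u * (A - 2 * (N + 1 : ℕ)) := by push_cast; ring
      rw [e1, e2]
      ring
  rw [h, Complex.sinh]
  congr 3
  ring

theorem sum_sinh_mul_sinh (u A : ℂ) (N : ℕ) :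
    2 * (∑ j ∈ Finset.range N, Complex.sinh (u * (A - 1 - 2 * j))) * Complex.sinh u =
      Complex.cosh (u * A) - Complex.cosh (u * (A - 2 * N)) := by
  induction N with
  | zero => simp
  | succ N ih =>
    rw [Finset.sum_range_succ, mul_add, add_mul, ih]
    have e1 : Complex.cosh (u * (A - 2 * N)) = Complex.cosh (u * (A - 1 - 2 * N) + u) := by
      congr 1; ring
    have e2 : Complex.cosh (u * (A - 2 * (N + 1 : ℕ))) =
        Complex.cosh (u * (A - 1 - 2 * N) - u) := by
      congr 1; push_cast; ring
    rw [e1, e2, Complex.cosh_add, Complex.cosh_sub]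
    ring

/-- Clebsch–Gordan rule for `sl₂` characters: both sides telescope to `(cosh(u(s+t)) -
cosh(u(s-t)))/2`. -/
theorem sinh_mul_sinh_eq_sum (u : ℂ) (s t : ℕ) :
    Complex.sinh (u * s) * Complex.sinh (u * t) =
      (∑ j ∈ Finset.range (min s t), Complex.sinh (u * ((s + t - 1 - 2 * j : ℕ) : ℂ))) *
        Complex.sinh u := by
  have h1 : ∑ j ∈ Finset.range (min s t), Complex.sinh (u * ((s + t - 1 - 2 * j : ℕ) : ℂ)) =
      ∑ j ∈ Finset.range (min s t), Complex.sinh (u * ((s + t : ℂ) - 1 - 2 * j)) := by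
    refine Finset.sum_congr rfl fun j hj => ?_
    rw [Finset.mem_range] at hj
    rw [Nat.cast_sub (by omega), Nat.cast_sub (by omega)]
    push_cast
    rfl
  have h2 : Complex.cosh (u * ((s + t : ℂ) - 2 * (min s t : ℕ))) =
      Complex.cosh (u * s - u * t) := by
    rcases le_total s t with h | h
    · rw [min_eq_left h, ← Complex.cosh_neg]; congr 1; ring
    · rw [min_eq_right h]; congr 1; ring
  have h3 := sum_sinh_mul_sinh u (s + t : ℂ) (min s t)
  rw [h2, mul_add, Complex.cosh_add, Complex.cosh_sub] at h3
  rw [h1]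
  linear_combination -(1 / 2 : ℂ) * h3

/-- For `l > p` this is `sinh(u(2p-l)) + 2 cosh(up) sinh(u(l-p)) = sinh(ul)`: the three modules
behave like one fictitious `M_{r,l}`, so Clebsch–Gordan needs no truncation. -/
theorem sum_dimVal_fusionTerm (p : ℕ) (u : ℂ) (w : ℂ → ℂ) (r : ℤ) {l : ℕ} (hl : l ≤ 2 * p) :
    ((fusionTerm p r l).map (dimVal p u w)).sum =
      Complex.exp (u * ((r - 1) * p)) * Complex.sinh (u * l) / Complex.sinh u := by
  unfold fusionTerm
  split_ifs with h
  · simp [dimVal]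
  · push Not at h
    simp only [Multiset.insert_eq_cons, Multiset.map_cons, Multiset.sum_cons,
      Multiset.map_singleton, Multiset.sum_singleton, dimVal]
    rw [Nat.cast_sub hl, Nat.cast_sub h.le]
    have e1 : Complex.exp (u * (((r + 1 : ℤ) - 1) * p)) =
        Complex.exp (u * ((r - 1) * p)) * Complex.exp (u * p) := by
      rw [← Complex.exp_add]; congr 1; push_cast; ring
    have e2 : Complex.exp (u * (((r - 1 : ℤ) - 1) * p)) =
        Complex.exp (u * ((r - 1) * p)) * Complex.exp (-(u * p)) := by
      rw [← Complex.exp_add]; congr 1; push_cast; ring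
    have e3 : Complex.sinh (u * l) = Complex.sinh (u * (l - p) + u * p) := by congr 1; ring
    have e4 : Complex.sinh (u * ((2 * p : ℕ) - l)) = -Complex.sinh (u * (l - p) - u * p) := by
      rw [← Complex.sinh_neg]; congr 1; push_cast; ring
    rw [e1, e2, e3, e4, ← Complex.cosh_add_sinh (u * p), ← Complex.cosh_sub_sinh (u * p),
      Complex.sinh_add, Complex.sinh_sub]
    ring

/-- Multiplicativity of the quantum dimensions for the fusion product. -/
theorem dimVal_mul {p : ℕ} {u : ℂ} (hu : Complex.sinh u ≠ 0) {w : ℂ → ℂ}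
    (hw : ∀ lam mu : ℂ, ∀ j : ℕ, w (lam + mu + j * (alphaMinus p : ℂ)) =
      w lam * w mu * Complex.exp (u * (p - 1 - 2 * j)))
    (hw' : ∀ (mu : ℂ) (r : ℤ) (s j : ℕ), w (mu + (weight p 1 ((s : ℤ) - 2 * j) (r - 1) : ℂ)) =
      w mu * Complex.exp (u * ((r - 1) * p)) * Complex.exp (u * (s - 1 - 2 * j)))
    {X Y : Label} (hX : IsModule p X) (hY : IsModule p Y) :
    dimVal p u w X * dimVal p u w Y = ((fusion p X Y).map (dimVal p u w)).sum := by
  have hm : ∀ (mu : ℂ) (r : ℤ) (s : ℕ), dimVal p u w (.atypical r s) *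
      dimVal p u w (.standard mu) = ∑ j ∈ Finset.range s,
        dimVal p u w (.standard (mu + (weight p 1 ((s : ℤ) - 2 * j) (r - 1) : ℂ))) := by
    intro mu r s
    simp only [dimVal, hw']
    rw [← Finset.sum_div, ← Finset.sum_mul, ← Finset.mul_sum, ← sum_exp_mul_sinh]
    field_simp
  rcases X with lam | ⟨r, s⟩ <;> rcases Y with mu | ⟨r', s'⟩
  · simp only [fusion, bind_pure_comp, Multiset.fmap_def, Multiset.map_map]
    change _ = ∑ j ∈ Finset.range p,
      dimVal p u w (.standard (lam + mu + j * (alphaMinus p : ℂ)))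
    simp only [dimVal, hw]
    rw [← Finset.sum_div, ← Finset.sum_mul, ← Finset.mul_sum, eq_div_iff hu]
    have := sum_exp_mul_sinh u p
    field_simp
    linear_combination -(w lam * w mu * Complex.sinh (u * p)) * this
  · rw [mul_comm]
    simp only [fusion, bind_pure_comp, Multiset.fmap_def, Multiset.map_map]
    exact hm lam r' s'
  · simp only [fusion, bind_pure_comp, Multiset.fmap_def, Multiset.map_map]
    exact hm mu r s
  · rw [fusion, Multiset.map_bind, Multiset.sum_bind]
    change _ = ∑ j ∈ Finset.range (min s s'),
      ((fusionTerm p (r + r' - 1) (s + s' - 1 - 2 * j)).map (dimVal p u w)).sum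
    obtain ⟨h1, h2⟩ := hX
    obtain ⟨h3, h4⟩ := hY
    rw [Finset.sum_congr rfl fun j _ => sum_dimVal_fusionTerm p u w (r + r' - 1)
      (l := s + s' - 1 - 2 * j) (by omega), ← Finset.sum_div, ← Finset.mul_sum]
    have h := sinh_mul_sinh_eq_sum u s s'
    have e : Complex.exp (u * (((r + r' - 1 : ℤ) - 1) * p)) =
        Complex.exp (u * ((r - 1) * p)) * Complex.exp (u * ((r' - 1) * p)) := by
      rw [← Complex.exp_add]; congr 1; push_cast; ring
    simp only [dimVal]
    rw [e]
    field_simp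
    linear_combination h

theorem isModule_of_mem_fusion {p : ℕ} {X Y Z : Label} (hX : IsModule p X) (hY : IsModule p Y)
    (hZ : Z ∈ fusion p X Y) : IsModule p Z := by
  rcases X with lam | ⟨r, s⟩ <;> rcases Y with mu | ⟨r', s'⟩
  · obtain ⟨j, -, rfl⟩ := Multiset.mem_map.1 hZ; trivial
  · obtain ⟨j, -, rfl⟩ := Multiset.mem_map.1 hZ; trivial
  · obtain ⟨j, -, rfl⟩ := Multiset.mem_map.1 hZ; trivial
  · obtain ⟨j, hj, hZ⟩ := Multiset.mem_bind.1 hZ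
    rw [Multiset.mem_range] at hj
    obtain ⟨h1, h2⟩ := hX
    obtain ⟨h3, h4⟩ := hY
    unfold fusionTerm at hZ
    split_ifs at hZ with h
    · rw [Multiset.mem_singleton] at hZ
      subst hZ
      exact ⟨by omega, h⟩
    · simp only [Multiset.insert_eq_cons, Multiset.mem_cons, Multiset.mem_singleton] at hZ
      rcases hZ with rfl | rfl | rfl <;> constructor <;> omega

/-! ### Weights in units of `1/√(2p)` and quantum dimensions as limits -/

/-- `1 / √(2 p)`, the unit of the weights of the atypical Fock modules. -/
noncomputable def unitWeight (p : ℕ) : ℝ := 1 / Real.sqrt (2 * p)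

theorem unitWeight_pos {p : ℕ} (hp : 0 < p) : 0 < unitWeight p := by
  have : (0 : ℝ) < p := by exact_mod_cast hp
  unfold unitWeight
  positivity

theorem unitWeight_sq {p : ℕ} (hp : 0 < p) : unitWeight p ^ 2 * (2 * p) = 1 := by
  have : (0 : ℝ) < p := by exact_mod_cast hp
  rw [unitWeight, div_pow, Real.sq_sqrt (by positivity)]
  field_simp

theorem alphaPlus_eq {p : ℕ} (hp : 0 < p) : alphaPlus p = 2 * p * unitWeight p := by
  have : (0 : ℝ) < p := by exact_mod_cast hp
  rw [alphaPlus, unitWeight, mul_one_div, Real.div_sqrt]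

theorem alphaMinus_eq {p : ℕ} (hp : 0 < p) : alphaMinus p = -(2 * unitWeight p) := by
  have hp' : (0 : ℝ) < p := by exact_mod_cast hp
  have h := unitWeight_pos hp
  rw [alphaMinus, neg_inj, Real.sqrt_eq_iff_mul_self_eq (by positivity) (by positivity)]
  have := unitWeight_sq hp
  field_simp
  linear_combination -this

theorem alphaZero_eq {p : ℕ} (hp : 0 < p) : alphaZero p = 2 * (p - 1) * unitWeight p := by
  rw [alphaZero, alphaPlus_eq hp, alphaMinus_eq hp]; ring

theorem weight_one_eq {p : ℕ} (hp : 0 < p) (s n : ℤ) :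
    weight p 1 s n = unitWeight p * (s - 1 + n * p) := by
  rw [weight, alphaPlus_eq hp, alphaMinus_eq hp]
  push_cast
  ring

/-- `η(i y)` times the regularised character at `τ = i y`. -/
noncomputable def numerator (p : ℕ) : Label → ℂ → ℝ → ℂ
  | .standard lam, ε, y => Complex.exp (2 * Real.pi * ε * (lam - (alphaZero p : ℂ) / 2) -
      Real.pi * y * (lam - (alphaZero p : ℂ) / 2) ^ 2)
  | .atypical r s, ε, y => if s = p then gauss (unitWeight p) ε y ((r - 1) * p)
      else atypSum (unitWeight p) p r s ε y

theorem fockChar_I_mul (p : ℕ) (lam ε : ℂ) (y : ℝ) : fockChar p lam ε (Complex.I * y) =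
    Complex.exp (2 * Real.pi * ε * (lam - (alphaZero p : ℂ) / 2) -
      Real.pi * y * (lam - (alphaZero p : ℂ) / 2) ^ 2) / ModularForm.eta (Complex.I * y) := by
  rw [fockChar, mul_div_assoc', ← Complex.exp_add]
  congr 2
  linear_combination Real.pi * y * (lam - (alphaZero p : ℂ) / 2) ^ 2 * Complex.I_sq

/-- Since `α_0/2 = (p-1)h`, the shifted weight is the integer multiple `s + (n-1)p` of `h`. -/
theorem fockChar_weight {p : ℕ} (hp : 0 < p) (s n x : ℤ) (hx : x = s + (n - 1) * p) (ε : ℂ)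
    (y : ℝ) : fockChar p (weight p 1 s n) ε (Complex.I * y) =
      gauss (unitWeight p) ε y x / ModularForm.eta (Complex.I * y) := by
  rw [fockChar_I_mul, gauss, weight_one_eq hp, alphaZero_eq hp, hx]
  congr 2
  push_cast
  ring

theorem regChar_eq {p : ℕ} (hp : 0 < p) (X : Label) (ε : ℂ) {y : ℝ} (hy : 0 < y) :
    regChar p X ε (Complex.I * y) = numerator p X ε y / ModularForm.eta (Complex.I * y) := by
  rcases X with lam | ⟨r, s⟩
  · exact fockChar_I_mul p lam ε y
  · simp only [regChar, atypicalChar, numerator]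
    split_ifs with h
    · exact fockChar_weight hp _ _ _ (by ring) ε y
    · have hh := unitWeight_pos hp
      have hs : ∀ x : ℤ, Summable fun k : ℕ => gauss (unitWeight p) ε y (x - 2 * p * k) :=
        fun x => (summable_gauss hh hp ε hy x).comp_injective Nat.cast_injective
      rw [atypSum, ← (hs _).tsum_sub (hs _), ← tsum_div_const]
      refine tsum_congr fun k => ?_
      rw [fockChar_weight hp _ _ (s + (r - 2) * p - 2 * p * k) (by ring),
        fockChar_weight hp _ _ (-s + (r - 2) * p - 2 * p * k) (by ring), sub_div]

/-- The limits of the rescaled characters determine the quantum dimensions. -/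
theorem hasQdim_of_tendsto {p : ℕ} (hp : 0 < p) {ε : ℂ} {g : ℝ → ℂ} {L : Label → ℂ}
    (hV : L vacuum ≠ 0)
    (hVL : Tendsto (fun y => g y * numerator p vacuum ε y) (𝓝[>] 0) (𝓝 (L vacuum)))
    {X : Label} (h : Tendsto (fun y => g y * numerator p X ε y) (𝓝[>] 0) (𝓝 (L X))) :
    HasQdim p X ε ∧ qdim p X ε = L X / L vacuum := by
  have hne := hVL.eventually_ne hV
  have hη : ∀ y : ℝ, 0 < y → ModularForm.eta (Complex.I * y) ≠ 0 := fun y hy =>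
    ModularForm.eta_ne_zero (by
      change 0 < (Complex.I * y : ℂ).im
      rwa [Complex.I_mul_im, Complex.ofReal_re])
  have hlim : Tendsto (charRatio p X ε) (𝓝[>] 0) (𝓝 (L X / L vacuum)) := by
    refine (h.div hVL hV).congr' ?_
    filter_upwards [hne, self_mem_nhdsWithin] with y hy hy0
    rw [charRatio, regChar_eq hp _ _ hy0, regChar_eq hp _ _ hy0,
      div_div_div_cancel_right₀ (hη y hy0), Pi.div_apply,
      mul_div_mul_left _ _ (left_ne_zero_of_mul hy)]
  refine ⟨⟨?_, _, hlim⟩, hlim.limUnder_eq⟩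
  filter_upwards [hne, self_mem_nhdsWithin] with y hy hy0
  rw [regChar_eq hp _ _ hy0]
  exact div_ne_zero (right_ne_zero_of_mul hy) (hη y hy0)

theorem sinh_ne_zero_of_re {v : ℂ} (hv : v.re ≠ 0) : Complex.sinh v ≠ 0 := by
  intro h
  refine one_sub_exp_ne_zero (v := -v - v) (by
    rw [Complex.sub_re, Complex.neg_re]; intro h'; exact hv (by linarith)) ?_
  rw [Complex.sinh, div_eq_zero_iff, or_iff_left two_ne_zero] at h
  rw [Complex.exp_sub, ← sub_eq_zero.1 h, div_self (Complex.exp_ne_zero _), sub_self]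

/-! ### Quantum dimensions in the two regimes -/

/-- The parameters `m / √(2 p)` with `p ∤ m` stay at distance at least `-B_ε^p` from `Im ε`. -/
theorem neg_wall_le (p : ℕ) (ε : ℂ) {m : ℤ} (hm : ¬ (p : ℤ) ∣ m) :
    -wall p ε ≤ |(m : ℝ) / Real.sqrt (2 * p) - ε.im| := by
  rw [wall, neg_neg]
  refine csInf_le ⟨0, ?_⟩ ⟨m, hm, rfl⟩
  rintro _ ⟨_, _, rfl⟩
  exact abs_nonneg _

theorem wall_nonpos (p : ℕ) (ε : ℂ) : wall p ε ≤ 0 := by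
  rw [wall, neg_nonpos]
  refine Real.sInf_nonneg ?_
  rintro _ ⟨_, _, rfl⟩
  exact abs_nonneg _

theorem div_sqrt_eq (p : ℕ) (m : ℤ) : (m : ℝ) / Real.sqrt (2 * p) = m * unitWeight p := by
  rw [unitWeight, mul_one_div]

/-- The quantum dimensions in the continuous regime. -/
theorem qdim_contRegime {p : ℕ} (hp : 2 ≤ p) {ε : ℂ} (hε : ε ∈ contRegime p) :
    Complex.sinh (2 * Real.pi * ε * unitWeight p) ≠ 0 ∧
      ∀ X, IsModule p X → HasQdim p X ε ∧
        qdim p X ε = dimVal p (2 * Real.pi * ε * unitWeight p)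
          (fun lam => Complex.exp (2 * Real.pi * ε * (lam - (alphaZero p : ℂ) / 2))) X := by
  obtain ⟨hw, h0⟩ := hε
  have hp0 : 0 < p := by omega
  have hh := unitWeight_pos hp0
  have hpos : 0 < 2 * Real.pi * unitWeight p := by have := Real.pi_pos; positivity
  set u : ℂ := 2 * Real.pi * ε * unitWeight p with hu
  have hs : ∀ n : ℕ, 0 < n → Complex.sinh (u * n) ≠ 0 := by
    intro n hn
    apply sinh_ne_zero_of_re
    have hn' : (0 : ℝ) < n := by exact_mod_cast hn
    have e : u * n = ((2 * Real.pi * unitWeight p * n : ℝ) : ℂ) * ε := by rw [hu]; push_cast; ring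
    rw [e, Complex.re_ofReal_mul]
    exact mul_ne_zero (mul_pos hpos hn').ne' h0
  have hs1 : Complex.sinh u ≠ 0 := by simpa using hs 1 one_pos
  refine ⟨hs1, ?_⟩
  have hatyp : ∀ r s : ℤ, Tendsto (atypSum (unitWeight p) p r s ε) (𝓝[>] 0)
      (𝓝 (Complex.exp (u * ((r - 1) * p)) * Complex.sinh (u * s) / Complex.sinh (u * p))) := by
    intro r s
    rcases lt_or_gt_of_ne h0 with hneg | hpos
    · have h1 := tendsto_atypSum_sub_thetaDiff hh hp0 hneg r s
      have h2 := tendsto_thetaDiff_zero hh hp0 (unitWeight_sq hp0) r s ε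
        -- For `wall p ε < Re ε < 0` the square of the wall exceeds `(Re ε)²`, and it bounds all
        -- relevant squared distances from below.
        (d := (wall p ε) ^ 2) (by nlinarith [wall_nonpos p ε]) (fun m hm => by
          have h3 := neg_wall_le p ε hm
          rw [div_sqrt_eq] at h3
          rw [← sq_abs (_ - _), ← neg_sq]
          exact pow_le_pow_left₀ (neg_nonneg.2 (wall_nonpos p ε)) h3 2)
      have h3 := h1.add h2
      rw [add_zero] at h3
      exact h3.congr fun y => by ring
    · exact tendsto_atypSum_of_pos hh hp0 hpos r s
  set L : Label → ℂ := fun X => match X with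
    | .standard lam => Complex.exp (2 * Real.pi * ε * (lam - (alphaZero p : ℂ) / 2))
    | .atypical r s => Complex.exp (u * ((r - 1) * p)) * Complex.sinh (u * s) /
        Complex.sinh (u * p) with hL
  have hlim : ∀ X, Tendsto (fun y => (1 : ℂ) * numerator p X ε y) (𝓝[>] 0) (𝓝 (L X)) := by
    intro X
    simp only [one_mul]
    rcases X with lam | ⟨r, s⟩
    · have : Continuous fun y : ℝ => numerator p (.standard lam) ε y := by
        unfold numerator; fun_prop
      have h := (this.tendsto 0).mono_left (nhdsWithin_le_nhds (s := Set.Ioi 0))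
      simpa only [numerator, Complex.ofReal_zero, mul_zero, zero_mul, sub_zero] using h
    · simp only [numerator, hL]
      split_ifs with h
      · subst h
        rw [mul_div_cancel_right₀ _ (hs s hp0)]
        have := tendsto_gauss (unitWeight s) ε ((r - 1) * s)
        push_cast at this
        exact this
      · exact_mod_cast hatyp r s
  have hV : L vacuum = Complex.sinh u / Complex.sinh (u * p) := by
    simp [hL, vacuum]
  have hV0 : L vacuum ≠ 0 := by
    rw [hV]; exact div_ne_zero hs1 (hs p hp0)
  intro X _
  obtain ⟨h1, h2⟩ := hasQdim_of_tendsto hp0 hV0 (hlim vacuum) (hlim X)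
  refine ⟨h1, h2.trans ?_⟩
  have := hs p hp0
  rw [hV]
  rcases X with lam | ⟨r, s⟩
  · simp only [hL, dimVal]
    field_simp
  · simp only [hL, dimVal]
    field_simp

theorem sinh_I_mul_ne_zero {p : ℕ} (hp : 0 < p) {m : ℤ} (hm : ¬ (p : ℤ) ∣ m) :
    Complex.sinh (Complex.I * Real.pi * m / p) ≠ 0 := by
  have hp' : (p : ℂ) ≠ 0 := by exact_mod_cast hp.ne'
  rw [show (Complex.I * Real.pi * m / p : ℂ) = (Real.pi * m / p : ℂ) * Complex.I by ring,
    Complex.sinh_mul_I]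
  refine mul_ne_zero (fun h => hm ?_) Complex.I_ne_zero
  obtain ⟨n, hn⟩ := Complex.sin_eq_zero_iff.1 h
  have hpi : (Real.pi : ℂ) ≠ 0 := by exact_mod_cast Real.pi_ne_zero
  field_simp at hn
  refine ⟨n, ?_⟩
  have h1 : (m : ℂ) = ((p * n : ℤ) : ℂ) := by push_cast; linear_combination hn
  exact_mod_cast h1

/-- The quantum dimensions in the discrete regime. -/
theorem qdim_discRegime {p : ℕ} (hp : 2 ≤ p) {ε : ℂ} (hε : ε ∈ discRegime p) {m : ℤ}
    (hm : ¬ (p : ℤ) ∣ m) (hmin : |(m : ℝ) / Real.sqrt (2 * p) - ε.im| = -wall p ε)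
    (X : Label) (hX : IsModule p X) : HasQdim p X ε ∧
      qdim p X ε = dimVal p (Complex.I * Real.pi * m / p) (fun _ => 0) X := by
  obtain ⟨hw, m', -, hm'⟩ := hε
  have hp0 : 0 < p := by omega
  have hp' : (p : ℂ) ≠ 0 := by exact_mod_cast hp0.ne'
  have hh := unitWeight_pos hp0
  have hw0 := wall_nonpos p ε
  set u : ℂ := Complex.I * Real.pi * m / p with hu
  have hs1 : Complex.sinh u ≠ 0 := sinh_I_mul_ne_zero hp0 hm
  have hsp : Complex.sinh (u * p) = 0 := by
    rw [hu, div_mul_cancel₀ _ hp', sinh_I_mul_pi_int]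
  have hlt : ∀ n : ℤ, ¬ (p : ℤ) ∣ n → n ≠ m →
      (m * unitWeight p - ε.im) ^ 2 < (n * unitWeight p - ε.im) ^ 2 := by
    intro n hn hne
    rw [sq_lt_sq, ← div_sqrt_eq, ← div_sqrt_eq, hmin]
    refine lt_of_le_of_ne (neg_wall_le p ε hn) fun h => hne ?_
    rw [hm' n ⟨hn, h.symm⟩, hm' m ⟨hm, hmin⟩]
  set z : ℂ := (ε - Complex.I * m * unitWeight p) ^ 2 with hz
  have hzre : 0 < z.re := by
    rw [hz, re_sq_sub, ← sq_abs (_ - ε.im), ← div_sqrt_eq, hmin]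
    nlinarith
  -- The reciprocal of the dominant growth: it kills the single Gaussians and the convergent part of
  -- the atypical sums, leaving only the coefficient at `m`.
  set g : ℝ → ℂ := fun y => (Real.sqrt (2 * p * y) : ℂ) * Complex.exp (-(Real.pi * z / y)) with hg
  have hg0 : Tendsto g (𝓝[>] 0) (𝓝 0) := tendsto_sqrt_mul_exp hzre p
  have hatyp : ∀ r s : ℤ, Tendsto (fun y => g y * atypSum (unitWeight p) p r s ε y) (𝓝[>] 0)
      (𝓝 (thetaCoeff p r s m)) := by
    intro r s
    have h1 := hg0.mul (tendsto_atypSum_sub_thetaDiff hh hp0 (hw.trans_le hw0) r s)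
    have h2 := tendsto_mul_thetaDiff hh hp0 (unitWeight_sq hp0) r s ε hlt
    have h3 := h1.add h2
    rw [zero_mul, zero_add] at h3
    exact h3.congr fun y => by simp only [hg, hz]; ring
  set L : Label → ℂ := fun X => match X with
    | .standard _ => 0
    | .atypical r s => thetaCoeff p r s m with hL
  have hlim : ∀ X, Tendsto (fun y => g y * numerator p X ε y) (𝓝[>] 0) (𝓝 (L X)) := by
    intro X
    rcases X with lam | ⟨r, s⟩
    · have : Continuous fun y : ℝ => numerator p (.standard lam) ε y := by
        unfold numerator; fun_prop
      have h := hg0.mul ((this.tendsto 0).mono_left (nhdsWithin_le_nhds (s := Set.Ioi 0)))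
      rwa [zero_mul] at h
    · simp only [numerator, hL]
      split_ifs with h
      · subst h
        have h1 := hg0.mul (tendsto_gauss (unitWeight s) ε ((r - 1) * s))
        -- For `s = p` the numerator is a single Gaussian, rescaled to `0`; the coefficient formula
        -- agrees because `sinh(iπm) = 0`.
        have h2 : thetaCoeff s r s m = 0 := by
          rw [thetaCoeff, ← hu, Int.cast_natCast, hsp, mul_zero, mul_zero]
        rwa [zero_mul, ← h2] at h1
      · exact hatyp r s
  have hV : L vacuum = Complex.exp (u * (-1 * p)) * (2 * Complex.sinh u) := by
    simp only [hL, vacuum, thetaCoeff, ← hu]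
    norm_num
  have hV0 : L vacuum ≠ 0 := by
    rw [hV]; exact mul_ne_zero (Complex.exp_ne_zero _) (mul_ne_zero two_ne_zero hs1)
  obtain ⟨h1, h2⟩ := hasQdim_of_tendsto hp0 hV0 (hlim vacuum) (hlim X)
  refine ⟨h1, h2.trans ?_⟩
  rw [hV]
  rcases X with lam | ⟨r, s⟩
  · simp [hL, dimVal]
  · have e : Complex.exp (u * ((r - 2) * p)) =
        Complex.exp (u * ((r - 1) * p)) * Complex.exp (u * (-1 * p)) := by
      rw [← Complex.exp_add]; congr 1; ring
    simp only [hL, dimVal, thetaCoeff, ← hu, e, Int.cast_natCast]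
    have := Complex.exp_ne_zero (u * (-1 * p))
    field_simp

/-- Unifies the regimes: `w` is an exponential in the weight for `D_+` and zero for `D_-`, and both
satisfy the relations required by `dimVal_mul`. -/
theorem exists_qdim_eq_dimVal {p : ℕ} (hp : 2 ≤ p) {ε : ℂ} (hε : ε ∈ contRegime p ∪ discRegime p) :
    ∃ (u : ℂ) (w : ℂ → ℂ), (∀ X, IsModule p X → HasQdim p X ε ∧ qdim p X ε = dimVal p u w X) ∧
      Complex.sinh u ≠ 0 ∧
      (∀ lam mu : ℂ, ∀ j : ℕ, w (lam + mu + j * (alphaMinus p : ℂ)) =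
        w lam * w mu * Complex.exp (u * (p - 1 - 2 * j))) ∧
      ∀ (mu : ℂ) (r : ℤ) (s j : ℕ), w (mu + (weight p 1 ((s : ℤ) - 2 * j) (r - 1) : ℂ)) =
        w mu * Complex.exp (u * ((r - 1) * p)) * Complex.exp (u * (s - 1 - 2 * j)) := by
  have hp0 : 0 < p := by omega
  rcases hε with hε | hε
  · obtain ⟨h1, h2⟩ := qdim_contRegime hp hε
    refine ⟨_, _, h2, h1, fun lam mu j => ?_, fun mu r s j => ?_⟩
    · rw [← Complex.exp_add, ← Complex.exp_add, alphaMinus_eq hp0, alphaZero_eq hp0]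
      congr 1
      push_cast
      ring
    · rw [← Complex.exp_add, ← Complex.exp_add, weight_one_eq hp0]
      congr 1
      push_cast
      ring
  · obtain ⟨m, ⟨hm, hmin⟩, -⟩ := hε.2
    refine ⟨_, _, qdim_discRegime hp hε hm hmin, sinh_I_mul_ne_zero hp0 hm, ?_, ?_⟩ <;> simp

/-! ### The ring of quantum dimensions -/

theorem qdim_mul_qdim {p : ℕ} (hp : 2 ≤ p) {ε : ℂ} (hε : ε ∈ contRegime p ∪ discRegime p)
    {X Y : Label} (hX : IsModule p X) (hY : IsModule p Y) :
    qdim p X ε * qdim p Y ε = ((fusion p X Y).map fun Z => qdim p Z ε).sum := by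
  obtain ⟨u, w, h, hu, hw, hw'⟩ := exists_qdim_eq_dimVal hp hε
  rw [(h X hX).2, (h Y hY).2, dimVal_mul hu hw hw' hX hY]
  congr 1
  exact Multiset.map_congr rfl fun Z hZ => ((h Z (isModule_of_mem_fusion hX hY hZ)).2).symm

theorem qdim_vacuum {p : ℕ} (hp : 2 ≤ p) {ε : ℂ} (hε : ε ∈ contRegime p ∪ discRegime p) :
    qdim p vacuum ε = 1 := by
  obtain ⟨u, w, h, hu, -, -⟩ := exists_qdim_eq_dimVal hp hε
  rw [(h vacuum ⟨le_rfl, by omega⟩).2, vacuum, dimVal]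
  simp [hu]

theorem qdim_mem_qdimSpace {p : ℕ} (U : Set ℂ) {X : Label} (hX : IsModule p X) :
    (fun ε : U => qdim p X ε) ∈ qdimSpace p U :=
  AddSubgroup.subset_closure ⟨X, hX, rfl⟩

theorem mul_mem_qdimSpace {p : ℕ} (hp : 2 ≤ p) {U : Set ℂ}
    (hU : U ⊆ contRegime p ∪ discRegime p) {f g : U → ℂ} (hf : f ∈ qdimSpace p U)
    (hg : g ∈ qdimSpace p U) : f * g ∈ qdimSpace p U := by
  induction hf using AddSubgroup.closure_induction with
  | zero => rw [zero_mul]; exact zero_mem _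
  | add a b _ _ ha hb => rw [add_mul]; exact add_mem ha hb
  | neg a _ ha => rw [neg_mul]; exact neg_mem ha
  | mem f hf =>
    obtain ⟨X, hX, rfl⟩ := hf
    induction hg using AddSubgroup.closure_induction with
    | zero => rw [mul_zero]; exact zero_mem _
    | add a b _ _ ha hb => rw [mul_add]; exact add_mem ha hb
    | neg a _ ha => rw [mul_neg]; exact neg_mem ha
    | mem g hg =>
      obtain ⟨Y, hY, rfl⟩ := hg
      have e : (fun ε : U => qdim p X ε) * (fun ε : U => qdim p Y ε) =
          ((fusion p X Y).map fun Z => fun ε : U => qdim p Z ε).sum := by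
        funext ε
        rw [Pi.mul_apply, qdim_mul_qdim hp (hU ε.2) hX hY, Pi.multiset_sum_apply,
          Multiset.map_map]
        rfl
      rw [e]
      refine AddSubgroup.multiset_sum_mem _ _ fun f hf => ?_
      obtain ⟨Z, hZ, rfl⟩ := Multiset.mem_map.1 hf
      exact qdim_mem_qdimSpace U (isModule_of_mem_fusion hX hY hZ)

/-- The ring of quantum dimensions on `U`. -/
def qdimRing {p : ℕ} (hp : 2 ≤ p) {U : Set ℂ} (hU : U ⊆ contRegime p ∪ discRegime p) :
    Subring (U → ℂ) :=
  { qdimSpace p U with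
    mul_mem' := mul_mem_qdimSpace hp hU
    one_mem' := by
      have e : (1 : U → ℂ) = fun ε : U => qdim p vacuum ε :=
        funext fun ε => (qdim_vacuum hp (hU ε.2)).symm
      rw [e]
      exact qdim_mem_qdimSpace U ⟨le_rfl, by omega⟩ }

/-! ### The discrete regime and the affine `S`-matrix -/

theorem exists_eq_add_or_sub {p : ℕ} (hp : 2 ≤ p) {m : ℤ} (hm : ¬ (p : ℤ) ∣ m) :
    ∃ (l : Fin (p - 2 + 1)) (t : ℤ), m = 2 * p * t + (l + 1) ∨ m = 2 * p * t - (l + 1) := by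
  have hp' : (0 : ℤ) < 2 * p := by omega
  have h1 := Int.emod_nonneg m hp'.ne'
  have h2 := Int.emod_lt_of_pos m hp'
  have h3 := Int.mul_ediv_add_emod m (2 * p)
  have h4 : m % (2 * p) ≠ 0 := fun h => hm ⟨2 * (m / (2 * p)), by rw [h] at h3; linarith⟩
  have h5 : m % (2 * p) ≠ p := fun h => hm ⟨2 * (m / (2 * p)) + 1, by rw [h] at h3; linarith⟩
  rcases lt_or_ge (m % (2 * p)) p with h | h
  · refine ⟨⟨(m % (2 * p) - 1).toNat, by omega⟩, m / (2 * p), Or.inl ?_⟩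
    have : (((m % (2 * p) - 1).toNat : ℕ) : ℤ) = m % (2 * p) - 1 := Int.toNat_of_nonneg (by omega)
    simp only [this]
    linarith
  · refine ⟨⟨(2 * p - m % (2 * p) - 1).toNat, by omega⟩, m / (2 * p) + 1, Or.inr ?_⟩
    have : (((2 * p - m % (2 * p) - 1).toNat : ℕ) : ℤ) = 2 * p - m % (2 * p) - 1 :=
      Int.toNat_of_nonneg (by omega)
    simp only [this]
    linarith

theorem sinh_I_mul_div_eq (p : ℕ) (m s : ℤ) : Complex.sinh (Complex.I * Real.pi * m / p * s) =
    ((Real.sin (Real.pi * m / p * s) : ℝ) : ℂ) * Complex.I := by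
  rw [Complex.ofReal_sin, ← Complex.sinh_mul_I]
  congr 1
  push_cast
  ring

/-- In the discrete regime the quantum dimensions of the `M_{1,s}`, `s < p`, are the generalised
quantum dimensions `S_{al} / S_{0l}` of the affine algebra. -/
theorem dimVal_eq_chi {p : ℕ} (hp : 2 ≤ p) {m t : ℤ} {l : Fin (p - 2 + 1)}
    (h : m = 2 * p * t + (l + 1) ∨ m = 2 * p * t - (l + 1)) (a : Fin (p - 2 + 1)) :
    dimVal p (Complex.I * Real.pi * m / p) (fun _ => 0) (.atypical 1 (a + 1)) =
      (AffineFusionRing.chi (p - 2) (AffineFusionRing.cls (p - 2) a) l : ℂ) := by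
  have hp' : (p : ℝ) ≠ 0 := by exact_mod_cast (by omega : p ≠ 0)
  have hk : ((p - 2 : ℕ) : ℝ) + 2 = p := by
    rw [Nat.cast_sub hp]; push_cast; ring
  -- Changing `m` to `-m` flips the sign of both sines and shifts by `2p` do not change them, so the
  -- ratio depends only on `l`.
  obtain ⟨σ, hσ0, hσ⟩ : ∃ σ : ℝ, σ ≠ 0 ∧ ∀ s : ℕ, Real.sin (Real.pi * m / p * s) =
      σ * Real.sin (Real.pi * (l + 1) / p * s) := by
    rcases h with h | h
    · refine ⟨1, one_ne_zero, fun s => ?_⟩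
      rw [one_mul, ← Real.sin_add_int_mul_two_pi _ (-(t * s)), h]
      congr 1
      push_cast
      field_simp
      ring
    · refine ⟨-1, by norm_num, fun s => ?_⟩
      rw [neg_one_mul, ← Real.sin_neg, ← Real.sin_add_int_mul_two_pi _ (-(t * s)), h]
      congr 1
      push_cast
      field_simp
      ring
  have h1 := hσ 1
  have h2 := hσ (a + 1)
  have e1 := sinh_I_mul_div_eq p m 1
  have e2 := sinh_I_mul_div_eq p m (a + 1 : ℕ)
  rw [Int.cast_one, mul_one] at e1
  rw [Nat.cast_one] at h1
  rw [Int.cast_natCast] at e2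
  rw [AffineFusionRing.chi_cls, dimVal, e1, e2]
  simp only [Int.cast_one, Int.cast_natCast, sub_self, zero_mul, mul_zero, Complex.exp_zero,
    one_mul]
  rw [h1, h2, mul_div_mul_right _ _ Complex.I_ne_zero, ← Complex.ofReal_div,
    mul_div_mul_left _ _ hσ0]
  congr 1
  simp only [affineS, Matrix.of_apply, hk]
  have hs : Real.sqrt (2 / (p : ℝ)) ≠ 0 := by
    have : (0 : ℝ) < p := by exact_mod_cast (by omega : 0 < p)
    positivity
  rw [mul_div_mul_left _ _ hs]
  congr 2
  · push_cast; ring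
  · simp

theorem exists_chi_eq_qdim {p : ℕ} (hp : 2 ≤ p) (ε : discRegime p) :
    ∃ l : Fin (p - 2 + 1), ∀ a : Fin (p - 2 + 1), qdim p (.atypical 1 ((a : ℕ) + 1)) ε =
      (AffineFusionRing.chi (p - 2) (AffineFusionRing.cls (p - 2) a) l : ℂ) := by
  obtain ⟨m, ⟨hm, hmin⟩, -⟩ := ε.2.2
  obtain ⟨l, t, h⟩ := exists_eq_add_or_sub hp hm
  refine ⟨l, fun a => ?_⟩
  rw [(qdim_discRegime hp ε.2 hm hmin (.atypical 1 (a + 1)) ⟨by omega, by omega⟩).2,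
    dimVal_eq_chi hp h]

/-- Every column of the affine `S`-matrix is attained in the discrete regime. -/
theorem exists_qdim_eq_chi {p : ℕ} (hp : 2 ≤ p) (l : Fin (p - 2 + 1)) :
    ∃ ε : discRegime p, ∀ a : Fin (p - 2 + 1), qdim p (.atypical 1 ((a : ℕ) + 1)) ε =
      (AffineFusionRing.chi (p - 2) (AffineFusionRing.cls (p - 2) a) l : ℂ) := by
  have hp0 : 0 < p := by omega
  set m : ℤ := (l : ℕ) + 1 with hm
  have hmp : ¬ (p : ℤ) ∣ m := by
    intro h
    have := Int.le_of_dvd (by omega) h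
    omega
  -- With `Im ε` exactly at `m/√(2p)` the wall is `0` and `m` is the unique minimiser, so any
  -- negative real part serves.
  set ε : ℂ := ⟨-1, (m : ℝ) / Real.sqrt (2 * p)⟩ with hε
  have h0 : |(m : ℝ) / Real.sqrt (2 * p) - ε.im| = 0 := by simp [hε]
  have hwall : wall p ε = 0 :=
    le_antisymm (wall_nonpos p ε) (by have := neg_wall_le p ε hmp; rw [h0] at this; linarith)
  have hmem : ε ∈ discRegime p := by
    refine ⟨by rw [hwall]; simp [hε], m, ⟨hmp, by rw [h0, hwall, neg_zero]⟩, ?_⟩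
    rintro n ⟨-, hn⟩
    rw [hwall, neg_zero, abs_eq_zero, sub_eq_zero, hε, div_sqrt_eq, div_sqrt_eq] at hn
    exact_mod_cast mul_right_cancel₀ (unitWeight_pos hp0).ne' hn
  refine ⟨⟨ε, hmem⟩, fun a => ?_⟩
  rw [(qdim_discRegime hp hmem hmp (by rw [h0, hwall, neg_zero]) (.atypical 1 (a + 1))
    ⟨by omega, by omega⟩).2,
    dimVal_eq_chi hp (l := l) (t := 0) (Or.inl (by rw [hm]; ring))]

theorem _root_.AffineFusionRing.chi_eq_sum (k : ℕ) (x : AffineFusionRing k) (l : Fin (k + 1)) :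
    AffineFusionRing.chi k x l =
      ∑ a, (x a : ℝ) * AffineFusionRing.chi k (AffineFusionRing.cls k a) l := by
  simp only [AffineFusionRing.chi_cls]
  rfl

/-- The realisation of the affine fusion ring by functions on the discrete regime. -/
noncomputable def affineHom {p : ℕ} (hp : 2 ≤ p) :
    AffineFusionRing (p - 2) →+* (discRegime p → ℂ) where
  toFun x ε := (AffineFusionRing.chi (p - 2) x (exists_chi_eq_qdim hp ε).choose : ℂ)
  map_one' := by funext ε; simp [AffineFusionRing.chi_one]
  map_mul' x y := by funext ε; simp [AffineFusionRing.chi_mul]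
  map_zero' := by funext ε; simp [AffineFusionRing.chi_zero]
  map_add' x y := by funext ε; simp [AffineFusionRing.chi_add]

theorem affineHom_cls {p : ℕ} (hp : 2 ≤ p) (a : Fin (p - 2 + 1)) :
    affineHom hp (AffineFusionRing.cls (p - 2) a) =
      fun ε : discRegime p => qdim p (.atypical 1 ((a : ℕ) + 1)) ε :=
  funext fun ε => ((exists_chi_eq_qdim hp ε).choose_spec a).symm

theorem affineHom_eq_sum {p : ℕ} (hp : 2 ≤ p) (x : AffineFusionRing (p - 2)) :
    affineHom hp x = ∑ a, x a • affineHom hp (AffineFusionRing.cls (p - 2) a) := by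
  funext ε
  rw [Finset.sum_apply]
  simp only [Pi.smul_apply, affineHom, RingHom.coe_mk, MonoidHom.coe_mk, OneHom.coe_mk,
    zsmul_eq_mul]
  rw [AffineFusionRing.chi_eq_sum]
  push_cast
  rfl

/-- Evaluating a relation at points realising each column `l` and clearing `S_{0l}` gives `cS = 0`;
then `S² = 1` forces `c = 0`. -/
theorem linearIndependent_qdim {p : ℕ} (hp : 2 ≤ p) :
    LinearIndependent ℂ (fun (a : Fin (p - 2 + 1)) (ε : discRegime p) =>
      qdim p (.atypical 1 ((a : ℕ) + 1)) ε) := by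
  rw [Fintype.linearIndependent_iff]
  intro c hc
  have h1 : ∀ l, ∑ a, c a * (affineS (p - 2) a l : ℂ) = 0 := by
    intro l
    obtain ⟨ε, hε⟩ := exists_qdim_eq_chi hp l
    have h2 := congrFun hc ε
    have h0 : (affineS (p - 2) 0 l : ℂ) ≠ 0 := by exact_mod_cast (affineS_zero_pos (p - 2) l).ne'
    simp only [Finset.sum_apply, Pi.smul_apply, hε, AffineFusionRing.chi_cls, smul_eq_mul,
      Pi.zero_apply, Complex.ofReal_div, ← mul_div_assoc] at h2
    rw [← Finset.sum_div, div_eq_zero_iff] at h2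
    exact h2.resolve_right h0
  have h3 : Matrix.vecMul c ((affineS (p - 2)).map (Complex.ofRealHom)) = 0 := by
    funext l
    simpa [Matrix.vecMul, dotProduct] using h1 l
  have h4 := congrArg (fun v => Matrix.vecMul v ((affineS (p - 2)).map (Complex.ofRealHom))) h3
  simp only [Matrix.vecMul_vecMul, ← Matrix.map_mul, affineS_mul_self, Matrix.zero_vecMul] at h4
  rw [Matrix.map_one _ (map_zero _) (map_one _), Matrix.vecMul_one] at h4
  exact fun a => congrFun h4 a

theorem affineHom_injective {p : ℕ} (hp : 2 ≤ p) : Function.Injective (affineHom hp) := by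
  rw [injective_iff_map_eq_zero]
  intro x hx
  rw [affineHom_eq_sum] at hx
  have h := Fintype.linearIndependent_iff.1 (linearIndependent_qdim hp) (fun a => (x a : ℂ)) (by
    rw [← hx]
    refine Finset.sum_congr rfl fun a _ => ?_
    rw [affineHom_cls, Int.cast_smul_eq_zsmul])
  funext a
  exact_mod_cast h a

/-- In the discrete regime, `M_{r,s}` has the quantum dimension of `M_{1,s}` for odd `r`, and the
opposite of that of `M_{1,p-s}` for even `r`. -/
theorem qdim_atypical_disc {p : ℕ} (hp : 2 ≤ p) (ε : discRegime p) (r : ℤ) {s : ℕ} (hs : 1 ≤ s)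
    (hsp : s < p) : qdim p (.atypical r s) ε =
      if Even r then -qdim p (.atypical 1 (p - s)) ε else qdim p (.atypical 1 s) ε := by
  obtain ⟨m, ⟨hm, hmin⟩, -⟩ := ε.2.2
  have hp' : (p : ℂ) ≠ 0 := by exact_mod_cast (by omega : p ≠ 0)
  have hq := qdim_discRegime hp ε.2 hm hmin
  rw [(hq (.atypical r s) ⟨hs, hsp.le⟩).2, (hq (.atypical 1 s) ⟨hs, hsp.le⟩).2,
    (hq (.atypical 1 (p - s)) ⟨by omega, by omega⟩).2]
  set u : ℂ := Complex.I * Real.pi * m / p with hu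
  have hup : u * p = m * (Real.pi * Complex.I) := by rw [hu]; field_simp
  have h2 : Complex.exp (u * (2 * p)) = 1 := by
    rw [show u * (2 * p) = m * (2 * Real.pi * Complex.I) by linear_combination 2 * hup,
      Complex.exp_int_mul_two_pi_mul_I]
  have hsh : Complex.sinh (u * p) = 0 := by
    rw [hu, div_mul_cancel₀ _ hp', sinh_I_mul_pi_int]
  have hper : ∀ j : ℤ, Complex.exp (u * (2 * p) * j) = 1 := by
    intro j
    rw [mul_comm, Complex.exp_int_mul, h2, one_zpow]
  simp only [dimVal]
  split_ifs with hr
  · obtain ⟨j, rfl⟩ := hr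
    -- As `sinh(up) = 0`, both `e^{up}` and the factor in `sinh(u(p-s)) = -cosh(up) sinh(us)` equal
    -- `cosh(up)` up to sign.
    have e1 : Complex.exp (u * (((j + j : ℤ) - 1) * p)) = Complex.cosh (u * p) := by
      rw [← Complex.cosh_add_sinh, ← add_zero (Complex.cosh (u * p)), ← hsh,
        Complex.cosh_add_sinh, Complex.cosh_add_sinh,
        show u * (((j + j : ℤ) - 1) * p) = u * (2 * p) * (j - 1 : ℤ) + u * p by push_cast; ring,
        Complex.exp_add, hper, one_mul]
    rw [e1, Nat.cast_sub hsp.le, mul_sub, Complex.sinh_sub, hsh]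
    simp
    ring
  · obtain ⟨j, rfl⟩ := Int.not_even_iff_odd.1 hr
    rw [show u * (((2 * j + 1 : ℤ) - 1) * p) = u * (2 * p) * j by push_cast; ring, hper]
    simp

/-- Fock modules and `M_{r,p}` have dimension zero on the discrete regime, and every other `M_{r,s}`
reduces by the parity of `r` to plus or minus a generator in the image. -/
theorem range_affineHom {p : ℕ} (hp : 2 ≤ p) :
    (affineHom hp).range.toAddSubgroup = qdimSpace p (discRegime p) := by
  have hp0 : 0 < p := by omega
  have hM : ∀ s : ℕ, 1 ≤ s → s < p → (fun ε : discRegime p => qdim p (.atypical 1 s) ε) ∈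
      (affineHom hp).range.toAddSubgroup := by
    intro s hs hsp
    refine ⟨AffineFusionRing.cls (p - 2) ⟨s - 1, by omega⟩, ?_⟩
    have : s - 1 + 1 = s := by omega
    have h := affineHom_cls hp ⟨s - 1, by omega⟩
    simp only [this] at h
    exact h
  apply le_antisymm
  · rintro _ ⟨x, rfl⟩
    change affineHom hp x ∈ _
    rw [affineHom_eq_sum]
    refine sum_mem fun a _ => zsmul_mem ?_ _
    rw [affineHom_cls]
    exact qdim_mem_qdimSpace _ ⟨by omega, by omega⟩
  · refine (AddSubgroup.closure_le _).2 ?_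
    rintro _ ⟨X, hX, rfl⟩
    by_cases hs : ∀ ε : discRegime p, qdim p X ε = 0
    · rw [show (fun ε : discRegime p => qdim p X ε) = 0 from funext hs]
      exact zero_mem _
    rcases X with lam | ⟨r, s⟩
    · refine absurd (fun ε => ?_) hs
      obtain ⟨m, ⟨hm, hmin⟩, -⟩ := ε.2.2
      rw [(qdim_discRegime hp ε.2 hm hmin _ hX).2]
      simp [dimVal]
    · obtain ⟨h1, h2⟩ := hX
      rcases h2.lt_or_eq with h2 | rfl
      · rw [show (fun ε : discRegime p => qdim p (.atypical r s) ε) = fun ε : discRegime p =>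
          if Even r then -qdim p (.atypical 1 (p - s)) ε else qdim p (.atypical 1 s) ε from
          funext fun ε => qdim_atypical_disc hp ε r h1 h2]
        by_cases hr : Even r
        · simp only [if_pos hr]
          exact neg_mem (hM (p - s) (by omega) (by omega))
        · simp only [if_neg hr]
          exact hM s h1 h2
      · refine absurd (fun ε => ?_) hs
        obtain ⟨m, ⟨hm, hmin⟩, -⟩ := ε.2.2
        have hs' : (s : ℂ) ≠ 0 := by exact_mod_cast hp0.ne'
        rw [(qdim_discRegime hp ε.2 hm hmin (.atypical r s) ⟨h1, le_rfl⟩).2, dimVal,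
          div_mul_cancel₀ _ hs', sinh_I_mul_pi_int, mul_zero, zero_div]

end Singlet

theorem mainTheorem7 (p : ℕ) (hp : 2 ≤ p) :
    -- the quantum dimensions exist in both regimes
    (∀ ε ∈ Singlet.contRegime p ∪ Singlet.discRegime p, ∀ X : Singlet.Label,
      Singlet.IsModule p X → Singlet.HasQdim p X ε) ∧
    -- the quantum dimension of the fusion product is the product of the quantum dimensions
    (∀ ε ∈ Singlet.contRegime p ∪ Singlet.discRegime p, ∀ X Y : Singlet.Label,
      Singlet.IsModule p X → Singlet.IsModule p Y →
        Singlet.qdim p X ε * Singlet.qdim p Y ε =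
          ((Singlet.fusion p X Y).map fun Z => Singlet.qdim p Z ε).sum) ∧
    -- the space of quantum dimensions is a ring of functions of `ε`
    (∀ U : Set ℂ, U ⊆ Singlet.contRegime p ∪ Singlet.discRegime p →
      ∃ S : Subring (U → ℂ), S.toAddSubgroup = Singlet.qdimSpace p U) ∧
    -- in the discrete regime it is the fusion ring of `A_1^(1)` at level `p - 2`
    LinearIndependent ℂ (fun (a : Fin (p - 2 + 1)) (ε : Singlet.discRegime p) =>
      Singlet.qdim p (.atypical 1 ((a : ℕ) + 1)) ε) ∧
    ∃ S : Subring (Singlet.discRegime p → ℂ),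
      S.toAddSubgroup = Singlet.qdimSpace p (Singlet.discRegime p) ∧
      ∃ φ : S ≃+* AffineFusionRing (p - 2), ∀ a : Fin (p - 2 + 1),
        ((φ.symm (AffineFusionRing.cls (p - 2) a) : S) : Singlet.discRegime p → ℂ) =
          fun ε : Singlet.discRegime p => Singlet.qdim p (.atypical 1 ((a : ℕ) + 1)) ε := by
  refine ⟨fun ε hε X hX => ?_, fun ε hε X Y hX hY => Singlet.qdim_mul_qdim hp hε hX hY,
    fun U hU => ⟨Singlet.qdimRing hp hU, rfl⟩, Singlet.linearIndependent_qdim hp,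
    (Singlet.affineHom hp).range, Singlet.range_affineHom hp,
    (RingEquiv.ofBijective (Singlet.affineHom hp).rangeRestrict
      ⟨fun x y h => Singlet.affineHom_injective hp (congrArg Subtype.val h),
        (Singlet.affineHom hp).rangeRestrict_surjective⟩).symm,
    fun a => Singlet.affineHom_cls hp a⟩
  obtain ⟨u, w, h, -⟩ := Singlet.exists_qdim_eq_dimVal hp hε
  exact (h X hX).1
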